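/- Let $d\ge 1$, $k\ge 0$. Consider the linear system $x_{t+1}=Ax_t+Bu_t+w_t$ with states $x_t\in\mathbb R^d$, controls $u_t\in\mathbb R^k$, known matrices $A\in\mathbb R^{d\times d}$, $B\in\mathbb R^{d\times k}$, and i.i.d. noise $w_t\sim\mathcal N(0,W)$; the system is initialized at $x_0=0$, no control acts before round $1$ ($u_0=0$, so $x_1=w_0$), and the rounds are $t=1,\dots,T$. The cost on round $t$ is $x_t^{\mathsf T}Q_tx_t+u_t^{\mathsf T}R_tu_t$, where the positive definite matrices $Q_1,\dots,Q_T$, $R_1,\dots,R_T$ are fixed in advance, $Q_t,R_t$ are revealed only after $u_t$ is played, and $\operatorname{tr}(Q_t),\operatorname{tr}(R_t)\le C$ for a constant $C>0$. For a strategy $\pi$ (on each round a, possibly randomized, choice of $u_t$ given $x_t$ and the earlier cost matrices) let $J_T(\pi)=\mathbb E\big[\sum_{t=1}^T x_t^{\mathsf T}Q_tx_t+u_t^{\mathsf T}R_tu_t\big]$. For $\kappa>0$ and $0<\gamma\le1$, a matrix $K\in\mathbb R^{k\times d}$ (and the linear policy $u_t=Kx_t$) is $(\kappa,\gamma)$-strongly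 stable if $\|K\|\le\kappa$ and $A+BK=HLH^{-1}$ for some real $d\times d$ matrices $L$, $H$ with $H$ invertible, $\|L\|\le1-\gamma$ and $\|H\|\,\|H^{-1}\|\le\kappa$, in spectral norm. For $\nu>0$ let $\mathcal S$ be the set of symmetric $(d+k)\times(d+k)$ matrices $\Sigma=\begin{pmatrix}\Sigma_{xx}&\Sigma_{xu}\\ \Sigma_{ux}&\Sigma_{uu}\end{pmatrix}\succeq0$ with $\operatorname{tr}(\Sigma)\le\nu$ and $\Sigma_{xx}=(A\ B)\,\Sigma\,(A\ B)^{\mathsf T}+W$. The online LQ controller with parameters $\eta,\nu>0$ starts from an arbitrary $\Sigma_1\in\mathcal S$; on each round $t$ it observes $x_t$, sets $K_t=(\Sigma_t)_{ux}(\Sigma_t)_{xx}^{-1}$ and $V_t=(\Sigma_t)_{uu}-K_t(\Sigma_t)_{xx}K_t^{\mathsf T}$, plays $u_t\sim\mathcal N(K_tx_t,V_t)$, receives $Q_t,R_t$, and sets $\Sigma_{t+1}=\Pi_{\mathcal S}\Big(\Sigma_t-\eta\begin{pmatrix}Q_t&0\\0&R_t\end{pmatrix}\Big)$, where $\Pi_{\mathcal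 S}$ is the Frobenius-norm projection onto $\mathcal S$. Theorem. There is an absolute constant $c>0$ with the following property. Let $\sigma,\lambda>0$ with $\operatorname{tr}(W)\le\lambda^2$ and $W\succeq\sigma^2I$, let $\kappa>0$, $0<\gamma\le1$, set $\nu=2\kappa^4\lambda^2/\gamma$ and $\eta=\sigma^3/(2C\sqrt{\nu T})$, and suppose $T\ge 8\kappa^4\lambda^2/(\gamma\sigma^2)$. Let $\mathcal A$ be the online LQ controller with these parameters, started at any $\Sigma_1\in\mathcal S$. Then for every $(\kappa,\gamma)$-strongly stable $K^\star$ the total costs of $\mathcal A$ and of $K^\star$ over the rounds $1,\dots,T$ are integrable, and $$J_T(\mathcal A)-J_T(K^\star)\;\le\; c\,\frac{\kappa^{10}\lambda^{5}}{\gamma^{2.5}\sigma^{3}}\,C\sqrt T .$$ -/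

import Mathlib

open MeasureTheory ProbabilityTheory Matrix

namespace OnlineLQ

noncomputable section

/-! ## States, controls and strong stability -/

/-- The state space `ℝᵈ`. -/
abbrev State (d : ℕ) : Type := EuclideanSpace ℝ (Fin d)

/-- The control space `ℝᵏ`. -/
abbrev Control (k : ℕ) : Type := EuclideanSpace ℝ (Fin k)

/-- The spectral (`ℓ² → ℓ²` operator) norm of a real matrix. -/
def opNorm {m n : Type*} [Fintype m] [Fintype n] [DecidableEq n] (M : Matrix m n ℝ) : ℝ :=
  ‖LinearMap.toContinuousLinearMap (Matrix.toEuclideanLin M)‖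

/-- The control matrix `K` is `(κ, γ)`-strongly stable for the dynamics `(A, B)`: `‖K‖ ≤ κ` and
`A + B K = H L H⁻¹` with `‖L‖ ≤ 1 - γ` and `‖H‖ ‖H⁻¹‖ ≤ κ`. -/
def IsStronglyStable {d k : ℕ} (A : Matrix (Fin d) (Fin d) ℝ) (B : Matrix (Fin d) (Fin k) ℝ)
    (κ γ : ℝ) (K : Matrix (Fin k) (Fin d) ℝ) : Prop :=
  0 < κ ∧ 0 < γ ∧ γ ≤ 1 ∧ opNorm K ≤ κ ∧
    ∃ L H : Matrix (Fin d) (Fin d) ℝ, IsUnit H.det ∧ A + B * K = H * L * H⁻¹ ∧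
      opNorm L ≤ 1 - γ ∧ opNorm H * opNorm H⁻¹ ≤ κ

/-! ## The controlled stochastic system -/

/-- The Gaussian kernel `a ↦ 𝒩(f a, V)`. -/
def gaussianKernel {α ι : Type*} [MeasurableSpace α] [Fintype ι] [DecidableEq ι]
    (f : α → EuclideanSpace ℝ ι) (hf : Measurable f) (V : Matrix ι ι ℝ) :
    Kernel α (EuclideanSpace ℝ ι) where
  toFun a := multivariateGaussian (f a) V
  measurable' := by
    refine Measure.measurable_of_measurable_coe _ fun s hs => ?_
    obtain ⟨L, hL⟩ : ∃ L : EuclideanSpace ℝ ι →L[ℝ] EuclideanSpace ℝ ι, ∀ m,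
        multivariateGaussian m V = (stdGaussian (EuclideanSpace ℝ ι)).map (fun x => m + L x) :=
      ⟨_, fun _ => rfl⟩
    have hg : Measurable fun p : α × EuclideanSpace ℝ ι => f p.1 + L p.2 := by fun_prop
    have h : (fun a => multivariateGaussian (f a) V s) = fun a =>
        stdGaussian (EuclideanSpace ℝ ι) (Prod.mk a ⁻¹'
          ((fun p : α × EuclideanSpace ℝ ι => f p.1 + L p.2) ⁻¹' s)) := by
      funext a
      rw [hL, Measure.map_apply (by fun_prop) hs]
      rfl
    rw [h]
    exact measurable_measure_prodMk_left (hg hs)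

instance {α ι : Type*} [MeasurableSpace α] [Fintype ι] [DecidableEq ι]
    (f : α → EuclideanSpace ℝ ι) (hf : Measurable f) (V : Matrix ι ι ℝ) :
    IsMarkovKernel (gaussianKernel f hf V) :=
  ⟨fun a => inferInstanceAs (IsProbabilityMeasure (multivariateGaussian (f a) V))⟩

/-- A (randomized, time-dependent) control strategy: on round `t`, at state `x`, the control is
drawn from the distribution `π t x`. -/
abbrev Strategy (d k : ℕ) : Type := ℕ → Kernel (State d) (Control k)

/-- The law of the next state `x' = A x + B u + w`, `w ∼ 𝒩(0, W)`, given `(x, u)`. -/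
def nextState {d k : ℕ} (A : Matrix (Fin d) (Fin d) ℝ) (B : Matrix (Fin d) (Fin k) ℝ)
    (W : Matrix (Fin d) (Fin d) ℝ) : Kernel (State d × Control k) (State d) :=
  gaussianKernel (fun z => toEuclideanLin A z.1 + toEuclideanLin B z.2)
    (by
      have hA := (LinearMap.continuous_of_finiteDimensional (toEuclideanLin A)).measurable
      have hB := (LinearMap.continuous_of_finiteDimensional (toEuclideanLin B)).measurable
      exact (hA.comp measurable_fst).add (hB.comp measurable_snd)) W

instance {d k : ℕ} (A : Matrix (Fin d) (Fin d) ℝ) (B : Matrix (Fin d) (Fin k) ℝ)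
    (W : Matrix (Fin d) (Fin d) ℝ) : IsMarkovKernel (nextState A B W) := by
  unfold nextState; infer_instance

/-- One step of the closed loop: from `(x, u)`, draw the next state `x'`, and then the next control
from the distribution `p x'`. -/
def step {d k : ℕ} (A : Matrix (Fin d) (Fin d) ℝ) (B : Matrix (Fin d) (Fin k) ℝ)
    (W : Matrix (Fin d) (Fin d) ℝ) (p : Kernel (State d) (Control k)) :
    Kernel (State d × Control k) (State d × Control k) :=
  Kernel.compProd (nextState A B W) (Kernel.prodMkLeft (State d × Control k) p)

instance {d k : ℕ} (A : Matrix (Fin d) (Fin d) ℝ) (B : Matrix (Fin d) (Fin k) ℝ)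
    (W : Matrix (Fin d) (Fin d) ℝ) (p : Kernel (State d) (Control k)) [IsMarkovKernel p] :
    IsMarkovKernel (step A B W p) := by
  unfold step; infer_instance

/-- The law of the infinite trajectory `((x₀, u₀), (x₁, u₁), …)` under the strategy `π`.
The system is initialized at `x₀ = 0` and no control acts before round `1` (`u₀ = 0`), so that
`x₁ = w₀`; the strategy is followed on the rounds `t = 1, 2, …`. -/
def trajectoryLaw {d k : ℕ} (A : Matrix (Fin d) (Fin d) ℝ) (B : Matrix (Fin d) (Fin k) ℝ)
    (W : Matrix (Fin d) (Fin d) ℝ) (π : Strategy d k) [∀ t, IsMarkovKernel (π t)] :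
    Measure (ℕ → State d × Control k) :=
  Kernel.trajMeasure (X := fun _ => State d × Control k) (Measure.dirac (0, 0))
    (fun n => (step A B W (π (n + 1))).comap (fun h => h ⟨n, Finset.mem_Iic.2 le_rfl⟩)
      (measurable_pi_apply _))

/-- The cost `∑_{t=1}^T (x_tᵀ Q_t x_t + u_tᵀ R_t u_t)` along a trajectory. -/
def totalCost {d k : ℕ} (Q : ℕ → Matrix (Fin d) (Fin d) ℝ) (R : ℕ → Matrix (Fin k) (Fin k) ℝ)
    (T : ℕ) (ω : ℕ → State d × Control k) : ℝ :=
  ∑ t ∈ Finset.Icc 1 T,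
    ((ω t).1 ⬝ᵥ (Q t *ᵥ (ω t).1) + (ω t).2 ⬝ᵥ (R t *ᵥ (ω t).2))

/-- The expected cost `J_T(π)`. -/
def expectedCost {d k : ℕ} (A : Matrix (Fin d) (Fin d) ℝ) (B : Matrix (Fin d) (Fin k) ℝ)
    (W : Matrix (Fin d) (Fin d) ℝ) (Q : ℕ → Matrix (Fin d) (Fin d) ℝ)
    (R : ℕ → Matrix (Fin k) (Fin k) ℝ) (T : ℕ) (π : Strategy d k) [∀ t, IsMarkovKernel (π t)] :
    ℝ :=
  ∫ ω, totalCost Q R T ω ∂(trajectoryLaw A B W π)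

/-- The stationary linear policy `u_t = K x_t`. -/
def linearPolicy {d k : ℕ} (K : Matrix (Fin k) (Fin d) ℝ) : Strategy d k := fun _ =>
  Kernel.deterministic (fun x => toEuclideanLin K x)
    (LinearMap.continuous_of_finiteDimensional (toEuclideanLin K)).measurable

instance {d k : ℕ} (K : Matrix (Fin k) (Fin d) ℝ) (t : ℕ) :
    IsMarkovKernel (linearPolicy K t) := by
  unfold linearPolicy; infer_instance

/-! ## The online gradient descent controller -/

/-- Symmetric `(d + k) × (d + k)` matrices are written in blocks indexed by `Fin d ⊕ Fin k`. -/
abbrev BlockMatrix (d k : ℕ) : Type := Matrix (Fin d ⊕ Fin k) (Fin d ⊕ Fin k) ℝ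

/-- The feasible set `𝒮` of the semidefinite program: `Σ ⪰ 0`, `tr Σ ≤ ν` and
`Σ_xx = (A B) Σ (A B)ᵀ + W`. -/
def sdpFeasible {d k : ℕ} (A : Matrix (Fin d) (Fin d) ℝ) (B : Matrix (Fin d) (Fin k) ℝ)
    (W : Matrix (Fin d) (Fin d) ℝ) (ν : ℝ) : Set (BlockMatrix d k) :=
  {S | S.PosSemidef ∧ S.trace ≤ ν ∧
    S.toBlocks₁₁ = fromCols A B * S * (fromCols A B)ᵀ + W}

/-- The Frobenius norm. -/
def frobNorm {m n : Type*} [Fintype m] [Fintype n] (M : Matrix m n ℝ) : ℝ :=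
  √(∑ i, ∑ j, M i j ^ 2)

/-- The Frobenius-norm projection of `M` onto `C`: a point of `C` closest to `M`. (It exists and is
unique when `C` is nonempty, closed and convex.) -/
def frobProj {m n : Type*} [Fintype m] [Fintype n] (C : Set (Matrix m n ℝ)) (M : Matrix m n ℝ) :
    Matrix m n ℝ :=
  Classical.epsilon fun P => P ∈ C ∧ ∀ Y ∈ C, frobNorm (M - P) ≤ frobNorm (M - Y)

/-- The iterates `Σ_t`, `t ≥ 1`, of projected online gradient descent with step size `η`, started
at `Σ₁`: `Σ_{t+1} = Π_𝒮(Σ_t - η diag(Q_t, R_t))`. (The value at `t = 0` is never used.) -/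
def ogdIterate {d k : ℕ} (A : Matrix (Fin d) (Fin d) ℝ) (B : Matrix (Fin d) (Fin k) ℝ)
    (W : Matrix (Fin d) (Fin d) ℝ) (Q : ℕ → Matrix (Fin d) (Fin d) ℝ)
    (R : ℕ → Matrix (Fin k) (Fin k) ℝ) (ν η : ℝ) (S₁ : BlockMatrix d k) : ℕ → BlockMatrix d k
  | 0 => S₁
  | 1 => S₁
  | t + 2 => frobProj (sdpFeasible A B W ν)
      (ogdIterate A B W Q R ν η S₁ (t + 1) - η • fromBlocks (Q (t + 1)) 0 0 (R (t + 1)))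

/-- The control matrix `𝒦(Σ) = Σ_ux Σ_xx⁻¹`. -/
def gain {d k : ℕ} (S : BlockMatrix d k) : Matrix (Fin k) (Fin d) ℝ :=
  S.toBlocks₂₁ * S.toBlocks₁₁⁻¹

/-- The exploration covariance `V = Σ_uu - K Σ_xx Kᵀ` with `K = 𝒦(Σ)`. -/
def explorationCov {d k : ℕ} (S : BlockMatrix d k) : Matrix (Fin k) (Fin k) ℝ :=
  S.toBlocks₂₂ - gain S * S.toBlocks₁₁ * (gain S)ᵀ

/-- The online LQ controller: on round `t`, at state `x_t`, it plays `u_t ∼ 𝒩(K_t x_t, V_t)` where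
`K_t`, `V_t` are extracted from the gradient descent iterate `Σ_t`, which depends on the costs of
the previous rounds only. -/
def onlineController {d k : ℕ} (A : Matrix (Fin d) (Fin d) ℝ) (B : Matrix (Fin d) (Fin k) ℝ)
    (W : Matrix (Fin d) (Fin d) ℝ) (Q : ℕ → Matrix (Fin d) (Fin d) ℝ)
    (R : ℕ → Matrix (Fin k) (Fin k) ℝ) (ν η : ℝ) (S₁ : BlockMatrix d k) : Strategy d k := fun t =>
  gaussianKernel (fun x => toEuclideanLin (gain (ogdIterate A B W Q R ν η S₁ t)) x)
    (LinearMap.continuous_of_finiteDimensional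
      (toEuclideanLin (gain (ogdIterate A B W Q R ν η S₁ t)))).measurable
    (explorationCov (ogdIterate A B W Q R ν η S₁ t))

instance {d k : ℕ} (A : Matrix (Fin d) (Fin d) ℝ) (B : Matrix (Fin d) (Fin k) ℝ)
    (W : Matrix (Fin d) (Fin d) ℝ) (Q : ℕ → Matrix (Fin d) (Fin d) ℝ)
    (R : ℕ → Matrix (Fin k) (Fin k) ℝ) (ν η : ℝ) (S₁ : BlockMatrix d k) (t : ℕ) :
    IsMarkovKernel (onlineController A B W Q R ν η S₁ t) := by
  unfold onlineController; infer_instance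

end

end OnlineLQ

open OnlineLQ

namespace OnlineLQ

/-! ## Positive semidefinite matrices and the Frobenius inner product -/

section LinearAlgebra

variable {m n : Type*} [Fintype m] [Fintype n]

/-! Every strategy involved draws its control with a linear conditional mean and a state-independent
covariance. Hence the second moment matrix M_t of (x_t, u_t) obeys a deterministic recursion, and
the expected cost is ∑ tr(L_t M_t) with L_t = diag(Q_t, R_t) (`expectedCost_eq_sum_trace`). What
remains is a question about linear losses on the convex set 𝒮, and the regret splits into three
pieces.

The stationary second moments Σ* of K* lie in 𝒮, so projected gradient descent bounds ∑ tr(L_t (Σ_t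
- Σ*)) (`sum_trace_ogdIterate_sub_le`). The actual moments under K* approach Σ* geometrically, at a
total cost independent of T (`sum_trace_stationary_sub_le`).

The third piece compares the controller's M_t with Σ_t. As L_t ⪰ 0, an upper bound M_t ⪯ (1 + c) Σ_t
suffices (`smul_sub_trajMoment_posSemidef`), and no stability of the gains K_t is needed. In one
step the noise enters without the factor 1 + c; since W ⪰ σ² I and Σ_xx ⪯ ν I, the excess c shrinks
by the factor 1 - σ²/ν (`next_posSemidef`). This pays for the drift of the iterates, at most η‖L_t‖,
so c can be taken proportional to η. A step size of order 1/√T then balances all terms. -/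

lemma posSemidef_iff_real {M : Matrix n n ℝ} :
    M.PosSemidef ↔ Mᵀ = M ∧ ∀ x : n → ℝ, 0 ≤ x ⬝ᵥ (M *ᵥ x) := by
  rw [posSemidef_iff_dotProduct_mulVec]
  simp [IsHermitian, conjTranspose_eq_transpose_of_trivial]

lemma _root_.Matrix.PosSemidef.transpose_eq {M : Matrix n n ℝ} (h : M.PosSemidef) : Mᵀ = M :=
  (posSemidef_iff_real.1 h).1

lemma _root_.Matrix.PosSemidef.mul_mul_transpose {M : Matrix n n ℝ} (h : M.PosSemidef) (N : Matrix m n ℝ) :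
    (N * M * Nᵀ).PosSemidef := by
  simpa [conjTranspose_eq_transpose_of_trivial] using h.mul_mul_conjTranspose_same N

lemma _root_.Matrix.PosSemidef.exists_gram {M : Matrix n n ℝ} (h : M.PosSemidef) :
    ∃ G : Matrix n n ℝ, M = Gᵀ * G := by
  classical
  open scoped MatrixOrder in
  obtain ⟨G, hG⟩ := CStarAlgebra.nonneg_iff_eq_star_mul_self.1 h.nonneg
  exact ⟨G, by simpa [star_eq_conjTranspose, conjTranspose_eq_transpose_of_trivial] using hG⟩

lemma _root_.Matrix.PosSemidef.trace_mul_nonneg {M N : Matrix n n ℝ} (hM : M.PosSemidef) (hN : N.PosSemidef) :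
    0 ≤ (M * N).trace := by
  obtain ⟨G, rfl⟩ := hN.exists_gram
  rw [← Matrix.mul_assoc, Matrix.trace_mul_comm, ← Matrix.mul_assoc]
  exact (hM.mul_mul_transpose G).trace_nonneg

lemma isClosed_posSemidef : IsClosed {M : Matrix n n ℝ | M.PosSemidef} := by
  simp only [posSemidef_iff_real, Set.ofPred_and, Set.ofPred_forall]
  refine (isClosed_eq (by fun_prop) (by fun_prop)).inter (isClosed_iInter fun x => ?_)
  exact isClosed_le continuous_const (by fun_prop)

/-- A matrix as a vector of the Euclidean space, so that the Euclidean norm is the Frobenius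
norm. -/
noncomputable def frobVec : Matrix m n ℝ ≃L[ℝ] EuclideanSpace ℝ (m × n) :=
  LinearEquiv.toContinuousLinearEquiv
    { toFun := fun M => WithLp.toLp 2 fun p => M p.1 p.2
      invFun := fun v => Matrix.of fun i j => v (i, j)
      left_inv := fun _ => rfl
      right_inv := fun _ => rfl
      map_add' := fun _ _ => rfl
      map_smul' := fun _ _ => rfl }

@[simp]
lemma frobVec_apply (M : Matrix m n ℝ) (p : m × n) : frobVec M p = M p.1 p.2 := rfl

lemma norm_frobVec (M : Matrix m n ℝ) : ‖frobVec M‖ = frobNorm M := by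
  simp [EuclideanSpace.norm_eq, frobNorm, Fintype.sum_prod_type]

lemma inner_frobVec (M N : Matrix m n ℝ) :
    inner ℝ (frobVec M) (frobVec N) = (Mᵀ * N).trace := by
  simp only [PiLp.inner_apply, frobVec_apply, Fintype.sum_prod_type, trace, diag_apply, mul_apply,
    transpose_apply, RCLike.inner_apply, conj_trivial]
  rw [Finset.sum_comm]
  exact Finset.sum_congr rfl fun _ _ => Finset.sum_congr rfl fun _ _ => mul_comm _ _

lemma frobNorm_nonneg (M : Matrix m n ℝ) : 0 ≤ frobNorm M := Real.sqrt_nonneg _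

lemma frobNorm_sq (M : Matrix m n ℝ) : frobNorm M ^ 2 = ∑ i, ∑ j, M i j ^ 2 :=
  Real.sq_sqrt (by positivity)

lemma trace_transpose_mul_le (M N : Matrix m n ℝ) :
    (Mᵀ * N).trace ≤ frobNorm M * frobNorm N := by
  rw [← inner_frobVec, ← norm_frobVec, ← norm_frobVec]
  exact real_inner_le_norm _ _

/-- Writing M as a Gram matrix, Cauchy–Schwarz gives M_ij² ≤ M_ii M_jj; summing over i and j yields
the square of the trace. -/
lemma _root_.Matrix.PosSemidef.frobNorm_le_trace {M : Matrix n n ℝ} (h : M.PosSemidef) :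
    frobNorm M ≤ M.trace := by
  obtain ⟨G, hG⟩ := h.exists_gram
  refine abs_le_of_sq_le_sq' ?_ h.trace_nonneg |>.2
  rw [frobNorm_sq, trace, pow_two, Finset.sum_mul_sum]
  refine Finset.sum_le_sum fun i _ => Finset.sum_le_sum fun j _ => ?_
  simp only [hG, diag_apply, mul_apply, transpose_apply]
  simpa [pow_two] using Finset.sum_mul_sq_le_sq_mul_sq Finset.univ (fun l => G l i) (fun l => G l j)

lemma _root_.Matrix.PosSemidef.trace_mul_le {M N : Matrix n n ℝ} (hM : M.PosSemidef) (hN : N.PosSemidef) :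
    (M * N).trace ≤ M.trace * N.trace := by
  have h := trace_transpose_mul_le M N
  rw [hM.transpose_eq] at h
  exact h.trans (mul_le_mul hM.frobNorm_le_trace hN.frobNorm_le_trace (frobNorm_nonneg _)
    hM.trace_nonneg)

lemma dotProduct_mulVec_le_frobNorm (N : Matrix n n ℝ) (x : n → ℝ) :
    x ⬝ᵥ (N *ᵥ x) ≤ frobNorm N * (x ⬝ᵥ x) := by
  have h := trace_transpose_mul_le N (vecMulVec x x)
  have h1 : (Nᵀ * vecMulVec x x).trace = x ⬝ᵥ (N *ᵥ x) := by
    simp only [trace, diag_apply, mul_apply, transpose_apply, vecMulVec_apply, dotProduct, mulVec,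
      Finset.mul_sum]
    rw [Finset.sum_comm]
    exact Finset.sum_congr rfl fun _ _ => Finset.sum_congr rfl fun _ _ => by ring
  have h2 : frobNorm (vecMulVec x x) = x ⬝ᵥ x := by
    have hx : 0 ≤ x ⬝ᵥ x := Finset.sum_nonneg fun i _ => mul_self_nonneg _
    rw [frobNorm, Real.sqrt_eq_iff_eq_sq (by positivity) hx, dotProduct, pow_two,
      Finset.sum_mul_sum]
    exact Finset.sum_congr rfl fun _ _ => Finset.sum_congr rfl fun _ _ => by
      simp only [vecMulVec_apply]; ring
  rwa [h1, h2] at h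

/-- Converts Frobenius closeness, which gradient descent provides, into the Loewner order, in which
the moment recursion is monotone. -/
lemma posSemidef_smul_one_sub [DecidableEq n] {N : Matrix n n ℝ} (hN : Nᵀ = N) {δ : ℝ}
    (h : frobNorm N ≤ δ) : (δ • (1 : Matrix n n ℝ) - N).PosSemidef := by
  refine posSemidef_iff_real.2 ⟨by simp [hN], fun x => ?_⟩
  have hx : 0 ≤ x ⬝ᵥ x := Finset.sum_nonneg fun i _ => mul_self_nonneg _
  have h1 := dotProduct_mulVec_le_frobNorm N x
  have h2 := mul_le_mul_of_nonneg_right h hx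
  simp only [sub_mulVec, smul_mulVec, one_mulVec, dotProduct_sub, dotProduct_smul, smul_eq_mul]
  linarith

lemma dotProduct_self_eq_norm_sq (x : n → ℝ) : x ⬝ᵥ x = ‖WithLp.toLp 2 x‖ ^ 2 := by
  rw [EuclideanSpace.real_norm_sq_eq]
  simp [dotProduct, pow_two]

lemma opNorm_nonneg [DecidableEq n] (M : Matrix m n ℝ) : 0 ≤ opNorm M := norm_nonneg _

lemma dotProduct_mulVec_self_le_opNorm [DecidableEq n] (N : Matrix m n ℝ) (x : n → ℝ) :
    (N *ᵥ x) ⬝ᵥ (N *ᵥ x) ≤ opNorm N ^ 2 * (x ⬝ᵥ x) := by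
  rw [dotProduct_self_eq_norm_sq, dotProduct_self_eq_norm_sq, ← mul_pow]
  have h := (LinearMap.toContinuousLinearMap (Matrix.toEuclideanLin N)).le_opNorm (WithLp.toLp 2 x)
  exact pow_le_pow_left₀ (norm_nonneg _) h 2

lemma posSemidef_opNorm_sq_smul_one_sub [DecidableEq n] (N : Matrix m n ℝ) :
    (opNorm N ^ 2 • (1 : Matrix n n ℝ) - Nᵀ * N).PosSemidef := by
  refine posSemidef_iff_real.2 ⟨by simp, fun x => ?_⟩
  have h := dotProduct_mulVec_self_le_opNorm N x
  simp only [sub_mulVec, smul_mulVec, one_mulVec, dotProduct_sub, dotProduct_smul, smul_eq_mul]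
  rw [← mulVec_mulVec, dotProduct_mulVec, vecMul_transpose]
  linarith

lemma _root_.Matrix.PosSemidef.trace_mul_mul_transpose_le [DecidableEq n] {M : Matrix n n ℝ} (hM : M.PosSemidef)
    (N : Matrix m n ℝ) : (N * M * Nᵀ).trace ≤ opNorm N ^ 2 * M.trace := by
  have h := (posSemidef_opNorm_sq_smul_one_sub N).trace_mul_nonneg hM
  rw [Matrix.sub_mul, trace_sub, Matrix.smul_mul, trace_smul, Matrix.one_mul, smul_eq_mul] at h
  rw [Matrix.mul_assoc, Matrix.trace_mul_comm, Matrix.mul_assoc, Matrix.trace_mul_comm]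
  linarith

/-! ### Projections and online gradient descent -/

/-- The choice made by `Classical.epsilon` is meaningful because a nonempty closed set in a
finite-dimensional space attains its distance to a point; convexity plays no role here. -/
lemma frobProj_spec {C : Set (Matrix m n ℝ)} (hC : IsClosed C) (hne : C.Nonempty)
    (M : Matrix m n ℝ) :
    frobProj C M ∈ C ∧ ∀ Y ∈ C, frobNorm (M - frobProj C M) ≤ frobNorm (M - Y) := by
  refine Classical.epsilon_spec
    (p := fun P => P ∈ C ∧ ∀ Y ∈ C, frobNorm (M - P) ≤ frobNorm (M - Y)) ?_
  have hcl : IsClosed (frobVec '' C) := frobVec.toHomeomorph.isClosedMap _ hC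
  obtain ⟨_, ⟨P, hP, rfl⟩, hd⟩ := hcl.exists_infDist_eq_dist (hne.image _) (frobVec M)
  refine ⟨P, hP, fun Y hY => ?_⟩
  have h := Metric.infDist_le_dist_of_mem (x := frobVec M) (Set.mem_image_of_mem frobVec hY)
  rw [hd, dist_eq_norm, dist_eq_norm, ← map_sub, ← map_sub, norm_frobVec, norm_frobVec] at h
  exact h

lemma inner_sub_frobProj_nonpos {C : Set (Matrix m n ℝ)} (hC : IsClosed C) (hcv : Convex ℝ C)
    (hne : C.Nonempty) (M : Matrix m n ℝ) {Y : Matrix m n ℝ} (hY : Y ∈ C) :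
    inner ℝ (frobVec M - frobVec (frobProj C M)) (frobVec Y - frobVec (frobProj C M)) ≤ 0 := by
  obtain ⟨hP, hmin⟩ := frobProj_spec hC hne M
  generalize frobProj C M = P at hP hmin
  have hcv' : Convex ℝ (frobVec '' C) := hcv.linear_image frobVec.toLinearEquiv.toLinearMap
  have hP' : frobVec P ∈ frobVec '' C := Set.mem_image_of_mem frobVec hP
  have hmin' : ‖frobVec M - frobVec P‖ = ⨅ w : frobVec '' C, ‖frobVec M - w‖ := by
    have : Nonempty (frobVec '' C) := ⟨⟨_, hP'⟩⟩
    refine le_antisymm (le_ciInf ?_) ?_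
    · rintro ⟨_, Y, hY, rfl⟩
      simpa only [← map_sub, norm_frobVec] using hmin Y hY
    · refine ciInf_le (f := fun w : frobVec '' C => ‖frobVec M - w‖) ⟨0, ?_⟩ ⟨_, hP'⟩
      rintro _ ⟨y, rfl⟩
      exact norm_nonneg _
  exact (norm_eq_iInf_iff_real_inner_le_zero hcv' hP').1 hmin' _ (Set.mem_image_of_mem frobVec hY)

end LinearAlgebra

/-! ### Projected gradient steps in an inner product space -/

section GradientDescent

variable {E : Type*} [NormedAddCommGroup E] [InnerProductSpace ℝ E]

/-- The projection inequality tested at the old iterate s gives ‖s - s'‖² ≤ η⟨g, s - s'⟩. This is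
the slow variation on which the tracking of Σ_t by the true moments rests. -/
lemma norm_sub_le_of_projected_step {η : ℝ} (hη : 0 ≤ η) {g s s' : E}
    (h : inner ℝ (s - η • g - s') (s - s') ≤ (0 : ℝ)) : ‖s - s'‖ ≤ η * ‖g‖ := by
  have h1 : ‖s - s'‖ * ‖s - s'‖ ≤ η * inner ℝ g (s - s') := by
    rw [show s - η • g - s' = (s - s') - η • g by abel, inner_sub_left, real_inner_smul_left,
      real_inner_self_eq_norm_mul_norm] at h
    linarith
  have h2 := mul_le_mul_of_nonneg_left (real_inner_le_norm g (s - s')) hη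
  rcases (norm_nonneg (s - s')).eq_or_lt with h0 | h0
  · rw [← h0]; positivity
  · exact le_of_mul_le_mul_right (by linarith) h0

/-- Projecting does not increase the distance to y; expanding ‖s - ηg - y‖² isolates the linear
term. -/
lemma inner_sub_le_of_projected_step {η : ℝ} (hη : 0 < η) {g s s' y : E}
    (h : inner ℝ (s - η • g - s') (y - s') ≤ (0 : ℝ)) :
    inner ℝ g (s - y) ≤ (‖s - y‖ ^ 2 - ‖s' - y‖ ^ 2) / (2 * η) + η / 2 * ‖g‖ ^ 2 := by
  have h1 : ‖s' - y‖ ^ 2 ≤ ‖s - η • g - y‖ ^ 2 := by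
    have e : s - η • g - y = (s - η • g - s') - (y - s') := by abel
    have := sq_nonneg ‖s - η • g - s'‖
    rw [e, norm_sub_sq_real (s - η • g - s'), norm_sub_rev s' y]
    linarith
  have h2 : ‖s - η • g - y‖ ^ 2 = ‖s - y‖ ^ 2 - 2 * η * inner ℝ g (s - y) + η ^ 2 * ‖g‖ ^ 2 := by
    rw [show s - η • g - y = (s - y) - η • g by abel, norm_sub_sq_real, real_inner_smul_right,
      norm_smul, real_inner_comm, mul_pow, Real.norm_eq_abs, sq_abs]
    ring
  have h3 : 2 * η * inner ℝ g (s - y) ≤ ‖s - y‖ ^ 2 - ‖s' - y‖ ^ 2 + η ^ 2 * ‖g‖ ^ 2 := by linarith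
  have h4 : inner ℝ g (s - y) ≤ (‖s - y‖ ^ 2 - ‖s' - y‖ ^ 2 + η ^ 2 * ‖g‖ ^ 2) / (2 * η) := by
    rw [le_div_iff₀ (by positivity)]; linarith
  refine h4.trans_eq ?_
  field_simp

/-- The regret bound of projected online gradient descent. -/
lemma sum_inner_le_of_projected_steps {η G D : ℝ} (hη : 0 < η) (s g : ℕ → E) (y : E) (T : ℕ)
    (h : ∀ t ∈ Finset.Icc 1 T, inner ℝ (s t - η • g t - s (t + 1)) (y - s (t + 1)) ≤ (0 : ℝ))
    (hg : ∀ t ∈ Finset.Icc 1 T, ‖g t‖ ≤ G) (hD : ‖s 1 - y‖ ≤ D) :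
    ∑ t ∈ Finset.Icc 1 T, inner ℝ (g t) (s t - y) ≤ D ^ 2 / (2 * η) + η / 2 * G ^ 2 * T := by
  -- The negative term at N + 1 is kept so that the sum telescopes; it is dropped only at N = T.
  have key : ∀ N ≤ T, ∑ t ∈ Finset.Icc 1 N, inner ℝ (g t) (s t - y) ≤
      (‖s 1 - y‖ ^ 2 - ‖s (N + 1) - y‖ ^ 2) / (2 * η) + η / 2 * G ^ 2 * N := by
    intro N hN
    induction N with
    | zero => simp
    | succ N ih =>
      have hmem : N + 1 ∈ Finset.Icc 1 T := Finset.mem_Icc.2 ⟨by omega, hN⟩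
      have h1 := inner_sub_le_of_projected_step hη (h _ hmem)
      have h2 : η / 2 * ‖g (N + 1)‖ ^ 2 ≤ η / 2 * G ^ 2 := by
        have := hg _ hmem
        gcongr
      rw [Finset.sum_Icc_succ_top (by omega)]
      refine (add_le_add (ih (by omega)) (h1.trans (add_le_add_right h2 _))).trans_eq ?_
      push_cast
      ring
  refine (key T le_rfl).trans ?_
  have h3 : ‖s 1 - y‖ ^ 2 ≤ D ^ 2 := pow_le_pow_left₀ (norm_nonneg _) hD 2
  have h4 := sq_nonneg ‖s (T + 1) - y‖
  gcongr
  linarith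

end GradientDescent

/-! ## Second moments along the trajectory -/

section SecondMoments

variable {Ω : Type*} [MeasurableSpace Ω] {m n ι : Type*} [Fintype m] [Fintype n] [Fintype ι]

/-- The random vector `z` has the matrix of (integrable) second moments `S` under `μ`. -/
def HasSecondMoment (μ : Measure Ω) (z : Ω → ι → ℝ) (S : Matrix ι ι ℝ) : Prop :=
  ∀ i j, Integrable (fun ω => z ω i * z ω j) μ ∧ ∫ ω, z ω i * z ω j ∂μ = S i j

/-- Under `p a` the random vector has mean `f a` and covariance matrix `V`. -/
def HasCondMoments (p : Kernel Ω (EuclideanSpace ℝ ι)) (f : Ω → ι → ℝ) (V : Matrix ι ι ℝ) : Prop :=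
  ∀ a, (∀ i, Integrable (fun y => y i) (p a) ∧ ∫ y, y i ∂(p a) = f a i) ∧
    ∀ i j, Integrable (fun y => y i * y j) (p a) ∧ ∫ y, y i * y j ∂(p a) = f a i * f a j + V i j

lemma HasSecondMoment.bilin {μ : Measure Ω} {z : Ω → ι → ℝ} {S : Matrix ι ι ℝ}
    (h : HasSecondMoment μ z S) (a b : ι → ℝ) :
    Integrable (fun ω => (a ⬝ᵥ z ω) * (b ⬝ᵥ z ω)) μ ∧
      ∫ ω, (a ⬝ᵥ z ω) * (b ⬝ᵥ z ω) ∂μ = a ⬝ᵥ (S *ᵥ b) := by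
  have e : (fun ω => (a ⬝ᵥ z ω) * (b ⬝ᵥ z ω)) =
      fun ω => ∑ i, ∑ j, a i * b j * (z ω i * z ω j) := by
    funext ω
    simp only [dotProduct, Finset.sum_mul_sum]
    exact Finset.sum_congr rfl fun _ _ => Finset.sum_congr rfl fun _ _ => by ring
  have hint : ∀ i, Integrable (fun ω => ∑ j, a i * b j * (z ω i * z ω j)) μ := fun i =>
    integrable_finsetSum _ fun j _ => (h i j).1.const_mul _
  rw [e]
  refine ⟨integrable_finsetSum _ fun i _ => hint i, ?_⟩
  rw [integral_finsetSum _ fun i _ => hint i]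
  simp only [dotProduct, mulVec, Finset.mul_sum]
  refine Finset.sum_congr rfl fun i _ => ?_
  rw [integral_finsetSum _ fun j _ => (h i j).1.const_mul _]
  refine Finset.sum_congr rfl fun j _ => ?_
  rw [integral_const_mul, (h i j).2]
  ring

lemma HasSecondMoment.quadratic {μ : Measure Ω} {z : Ω → ι → ℝ} {S : Matrix ι ι ℝ}
    (h : HasSecondMoment μ z S) (L : Matrix ι ι ℝ) :
    Integrable (fun ω => z ω ⬝ᵥ (L *ᵥ z ω)) μ ∧
      ∫ ω, z ω ⬝ᵥ (L *ᵥ z ω) ∂μ = (Lᵀ * S).trace := by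
  have e : (fun ω => z ω ⬝ᵥ (L *ᵥ z ω)) = fun ω => ∑ i, ∑ j, L i j * (z ω i * z ω j) := by
    funext ω
    simp only [dotProduct, mulVec, Finset.mul_sum]
    exact Finset.sum_congr rfl fun _ _ => Finset.sum_congr rfl fun _ _ => by ring
  have hint : ∀ i, Integrable (fun ω => ∑ j, L i j * (z ω i * z ω j)) μ := fun i =>
    integrable_finsetSum _ fun j _ => (h i j).1.const_mul _
  rw [e]
  refine ⟨integrable_finsetSum _ fun i _ => hint i, ?_⟩
  rw [integral_finsetSum _ fun i _ => hint i]
  simp only [trace, diag_apply, mul_apply, transpose_apply]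
  rw [Finset.sum_comm]
  refine Finset.sum_congr rfl fun i _ => ?_
  rw [integral_finsetSum _ fun j _ => (h i j).1.const_mul _]
  refine Finset.sum_congr rfl fun j _ => ?_
  rw [integral_const_mul, (h i j).2]

lemma hasSecondMoment_map_iff {Ω' l : Type*} [MeasurableSpace Ω'] {μ : Measure Ω} {f : Ω → Ω'}
    (hf : Measurable f) {z : Ω' → l → ℝ} (hz : ∀ i, Measurable fun ω => z ω i)
    {S : Matrix l l ℝ} :
    HasSecondMoment (μ.map f) z S ↔ HasSecondMoment μ (fun ω => z (f ω)) S := by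
  refine forall₂_congr fun i j => ?_
  have hm : AEStronglyMeasurable (fun ω => z ω i * z ω j) (μ.map f) :=
    ((hz i).mul (hz j)).aestronglyMeasurable
  rw [integrable_map_measure hm hf.aemeasurable, integral_map hf.aemeasurable hm]
  rfl

lemma integrable_mul_of_sq {μ : Measure Ω} {f g : Ω → ℝ} (hf : Measurable f) (hg : Measurable g)
    (hf2 : Integrable (fun ω => f ω * f ω) μ) (hg2 : Integrable (fun ω => g ω * g ω) μ) :
    Integrable (fun ω => f ω * g ω) μ := by
  have h1 : MemLp f 2 μ := (memLp_two_iff_integrable_sq hf.aestronglyMeasurable).2 (by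
    simpa only [pow_two] using hf2)
  have h2 : MemLp g 2 μ := (memLp_two_iff_integrable_sq hg.aestronglyMeasurable).2 (by
    simpa only [pow_two] using hg2)
  exact h1.integrable_mul h2

/-- Second moments of the joint law of `z` and of a draw from a kernel with conditional mean `K z`
and conditional covariance `V`. -/
lemma HasSecondMoment.compProd {ν : Measure Ω} [IsProbabilityMeasure ν]
    {p : Kernel Ω (EuclideanSpace ℝ n)} [IsMarkovKernel p] {g : Ω → m → ℝ}
    (hg : ∀ i, Measurable fun ω => g ω i) {X : Matrix m m ℝ} (hX : HasSecondMoment ν g X)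
    {K : Matrix n m ℝ} {V : Matrix n n ℝ} (hp : HasCondMoments p (fun a => K *ᵥ g a) V) :
    HasSecondMoment (ν ⊗ₘ p) (fun q => Sum.elim (g q.1) q.2)
      (fromBlocks X (X * Kᵀ) (K * X) (K * X * Kᵀ + V)) := by
  have hX1 : ∀ i j, Integrable (fun q : Ω × EuclideanSpace ℝ n => g q.1 i * g q.1 j) (ν ⊗ₘ p) := by
    intro i j
    have h := (hX i j).1
    rw [← Measure.fst_compProd ν p] at h
    exact h.comp_measurable measurable_fst
  have hKK : ∀ i j, Integrable (fun a => (K *ᵥ g a) i * (K *ᵥ g a) j) ν ∧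
      ∫ a, (K *ᵥ g a) i * (K *ᵥ g a) j ∂ν = (K * X * Kᵀ) i j := by
    intro i j
    have h := hX.bilin (K i) (K j)
    refine ⟨h.1, h.2.trans ?_⟩
    rw [Matrix.mul_assoc, Matrix.mul_apply]
    rfl
  -- Only squares need a direct integrability check, through the conditional second moment; mixed
  -- products then follow since both factors are in L².
  have hY2 : ∀ i, Integrable (fun q : Ω × EuclideanSpace ℝ n => q.2 i * q.2 i) (ν ⊗ₘ p) := by
    intro i
    refine (Measure.integrable_compProd_iff (by fun_prop)).2
      ⟨Filter.Eventually.of_forall fun a => ((hp a).2 i i).1, ?_⟩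
    simp only [Real.norm_eq_abs, abs_mul_self]
    simp only [((hp _).2 i i).2]
    exact (hKK i i).1.add (integrable_const _)
  have hgm : ∀ i, Measurable fun q : Ω × EuclideanSpace ℝ n => g q.1 i := fun i =>
    (hg i).comp measurable_fst
  have hym : ∀ i, Measurable fun q : Ω × EuclideanSpace ℝ n => q.2 i := fun i => by fun_prop
  have hXY : ∀ i j, Integrable (fun q : Ω × EuclideanSpace ℝ n => g q.1 i * q.2 j) (ν ⊗ₘ p) ∧
      ∫ q, g q.1 i * q.2 j ∂(ν ⊗ₘ p) = (X * Kᵀ) i j := by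
    classical
    intro i j
    have h := integrable_mul_of_sq (hgm i) (hym j) (hX1 i i) (hY2 j)
    refine ⟨h, ?_⟩
    rw [Measure.integral_compProd h]
    simp only [integral_const_mul, ((hp _).1 j).2]
    have h2 := (hX.bilin (Pi.single i 1) (K j)).2
    simp only [single_one_dotProduct] at h2
    exact h2
  rintro (i | i) (j | j)
  · refine ⟨hX1 i j, ?_⟩
    simp only [Sum.elim_inl, fromBlocks_apply₁₁]
    rw [Measure.integral_compProd (hX1 i j)]
    simpa using (hX i j).2
  · exact hXY i j
  · have h := hXY j i
    simp only [mul_comm (g _ j)] at h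
    refine ⟨h.1, h.2.trans ?_⟩
    have hsymm : ∀ a b, X a b = X b a := fun a b => by
      rw [← (hX a b).2, ← (hX b a).2]
      simp only [mul_comm]
    simp only [fromBlocks_apply₂₁, mul_apply, transpose_apply]
    exact Finset.sum_congr rfl fun l _ => by rw [hsymm, mul_comm]
  · have h := integrable_mul_of_sq (hym i) (hym j) (hY2 i) (hY2 j)
    refine ⟨h, ?_⟩
    simp only [Sum.elim_inr, fromBlocks_apply₂₂]
    rw [Measure.integral_compProd h]
    simp only [((hp _).2 i j).2]
    rw [integral_add (hKK i j).1 (integrable_const _), (hKK i j).2]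
    simp

lemma hasCondMoments_gaussianKernel [DecidableEq ι] (f : Ω → EuclideanSpace ℝ ι)
    (hf : Measurable f) {V : Matrix ι ι ℝ} (hV : V.PosSemidef) :
    HasCondMoments (gaussianKernel f hf V) (fun a => f a) V := by
  intro a
  change (∀ i, Integrable (fun y => y i) (multivariateGaussian (f a) V) ∧
    ∫ y, y i ∂(multivariateGaussian (f a) V) = f a i) ∧
    ∀ i j, Integrable (fun y => y i * y j) (multivariateGaussian (f a) V) ∧
      ∫ y, y i * y j ∂(multivariateGaussian (f a) V) = f a i * f a j + V i j
  have hL2 : ∀ i, MemLp (fun y : EuclideanSpace ℝ ι => y i) 2 (multivariateGaussian (f a) V) :=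
    fun i => ContinuousLinearMap.comp_memLp' (EuclideanSpace.proj (𝕜 := ℝ) i)
      (IsGaussian.memLp_two_id (μ := multivariateGaussian (f a) V))
  have hmean : ∀ i, ∫ y, y i ∂(multivariateGaussian (f a) V) = f a i := fun i => by
    have h := (EuclideanSpace.proj (𝕜 := ℝ) i).integral_comp_comm
      (IsGaussian.integrable_id (μ := multivariateGaussian (f a) V))
    simpa using h
  refine ⟨fun i => ⟨(hL2 i).integrable (by norm_num), hmean i⟩, fun i j => ?_⟩
  refine ⟨(hL2 i).integrable_mul (hL2 j), ?_⟩
  have h := covariance_eval_multivariateGaussian (μ := f a) hV i j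
  rw [covariance_eq_sub (hL2 i) (hL2 j), hmean, hmean] at h
  rw [← h]
  simp

/-- Treats a linear policy as one with zero exploration, so that comparator and controller share one
moment recursion. -/
lemma hasCondMoments_deterministic {f : Ω → EuclideanSpace ℝ ι} (hf : Measurable f) :
    HasCondMoments (Kernel.deterministic f hf) (fun a => f a) 0 := by
  intro a
  simp only [Kernel.deterministic_apply]
  refine ⟨fun i => ⟨?_, ?_⟩, fun i j => ⟨?_, ?_⟩⟩
  · exact integrable_dirac enorm_lt_top
  · rw [integral_dirac]
  · exact integrable_dirac enorm_lt_top
  · rw [integral_dirac]; simp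

end SecondMoments

/-! ### Marginal laws of the closed loop and their moment recursion -/

section Trajectory

variable {d k : ℕ} (A : Matrix (Fin d) (Fin d) ℝ) (B : Matrix (Fin d) (Fin k) ℝ)
  (W : Matrix (Fin d) (Fin d) ℝ)

/-- A state-control pair as a vector indexed by `Fin d ⊕ Fin k`. -/
def joint (z : State d × Control k) : Fin d ⊕ Fin k → ℝ := Sum.elim z.1 z.2

lemma measurable_joint (i : Fin d ⊕ Fin k) :
    Measurable fun z : State d × Control k => joint z i := by
  cases i <;> simp only [joint, Sum.elim_inl, Sum.elim_inr] <;> fun_prop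

instance (π : Strategy d k) [∀ t, IsMarkovKernel (π t)] :
    IsProbabilityMeasure (trajectoryLaw A B W π) := by
  unfold trajectoryLaw; infer_instance

instance (π : Strategy d k) [∀ t, IsMarkovKernel (π t)] (t : ℕ) :
    IsProbabilityMeasure ((trajectoryLaw A B W π).map fun ω => ω t) :=
  Measure.isProbabilityMeasure_map (measurable_pi_apply t).aemeasurable

lemma map_eval_zero_trajectoryLaw (π : Strategy d k) [∀ t, IsMarkovKernel (π t)] :
    (trajectoryLaw A B W π).map (fun ω => ω 0) = Measure.dirac (0, 0) := by
  have h : (fun ω : ℕ → State d × Control k => ω 0) =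
      (fun h : (i : Finset.Iic 0) → State d × Control k => h ⟨0, Finset.mem_Iic.2 le_rfl⟩) ∘
        Preorder.frestrictLe (π := fun _ => State d × Control k) 0 := rfl
  rw [h, ← Measure.map_map (by fun_prop) (by fun_prop), trajectoryLaw, Kernel.trajMeasure,
    Measure.map_comp _ _ (by fun_prop), Kernel.traj_map_frestrictLe, Kernel.partialTraj_self,
    Measure.id_comp, Measure.map_map (by fun_prop) (by fun_prop)]
  exact Measure.map_id

/-- Markov property: the kernel producing coordinate t + 1 reads only the last coordinate of the
history, so the one-time marginals satisfy a closed recursion. -/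
lemma map_eval_succ_trajectoryLaw (π : Strategy d k) [∀ t, IsMarkovKernel (π t)] (t : ℕ) :
    (trajectoryLaw A B W π).map (fun ω => ω (t + 1)) =
      (((trajectoryLaw A B W π).map (fun ω => ω t) ⊗ₘ nextState A B W).snd) ⊗ₘ π (t + 1) := by
  set κ : (n : ℕ) → Kernel ((i : Finset.Iic n) → State d × Control k) (State d × Control k) :=
    fun n => (step A B W (π (n + 1))).comap (fun h => h ⟨n, Finset.mem_Iic.2 le_rfl⟩)
      (measurable_pi_apply _) with hκ
  have h := Kernel.map_frestrictLe_trajMeasure_compProd_eq_map_trajMeasure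
    (X := fun _ => State d × Control k) (μ₀ := Measure.dirac (0, 0)) (κ := κ) (a := t)
  have h2 := congrArg Measure.snd h
  rw [Measure.snd_compProd, Measure.snd, Measure.map_map (by fun_prop) (by fun_prop)] at h2
  have h3 : (trajectoryLaw A B W π).map (fun ω => ω (t + 1)) =
      κ t ∘ₘ (trajectoryLaw A B W π).map
        (Preorder.frestrictLe (π := fun _ => State d × Control k) t) := h2.symm
  have h4 : κ t = (step A B W (π (t + 1))) ∘ₖ
      Kernel.deterministic (fun h : (i : Finset.Iic t) → State d × Control k =>
        h ⟨t, Finset.mem_Iic.2 le_rfl⟩) (measurable_pi_apply _) := by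
    rw [Kernel.comp_deterministic_eq_comap]
  rw [h3, h4, ← Measure.comp_assoc, Measure.deterministic_comp_eq_map,
    Measure.map_map (by fun_prop) (by fun_prop), Measure.snd_compProd,
    Measure.compProd_eq_comp_prod, Measure.comp_assoc]
  congr 1
  rw [step, Kernel.compProd_prodMkLeft_eq_comp]

/-- The second moments of `(x_t, u_t)` when `u_t` has conditional mean `K_t x_t` and conditional
covariance `V_t`. -/
noncomputable def trajMoment (K : ℕ → Matrix (Fin k) (Fin d) ℝ) (V : ℕ → Matrix (Fin k) (Fin k) ℝ) :
    ℕ → BlockMatrix d k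
  | 0 => 0
  | t + 1 =>
    let X := fromCols A B * trajMoment K V t * (fromCols A B)ᵀ + W
    fromBlocks X (X * (K (t + 1))ᵀ) (K (t + 1) * X) (K (t + 1) * X * (K (t + 1))ᵀ + V (t + 1))

variable {A B W}

lemma hasCondMoments_nextState (hW : W.PosSemidef) :
    HasCondMoments (nextState A B W) (fun z => fromCols A B *ᵥ joint z) W := by
  have h := hasCondMoments_gaussianKernel (fun z : State d × Control k =>
    toEuclideanLin A z.1 + toEuclideanLin B z.2)
    (by
      have hA := (LinearMap.continuous_of_finiteDimensional (toEuclideanLin A)).measurable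
      have hB := (LinearMap.continuous_of_finiteDimensional (toEuclideanLin B)).measurable
      exact (hA.comp measurable_fst).add (hB.comp measurable_snd)) hW
  have e : (fun z : State d × Control k => fromCols A B *ᵥ joint z) = fun z =>
      (toEuclideanLin A z.1 + toEuclideanLin B z.2 : State d).ofLp :=
    funext fun z => fromCols_mulVec_sumElim A B z.1.ofLp z.2.ofLp
  rw [e]
  exact h

lemma hasSecondMoment_trajectoryLaw (hW : W.PosSemidef) (π : Strategy d k)
    [∀ t, IsMarkovKernel (π t)] {K : ℕ → Matrix (Fin k) (Fin d) ℝ}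
    {V : ℕ → Matrix (Fin k) (Fin k) ℝ}
    (hπ : ∀ t, HasCondMoments (π t) (fun x => K t *ᵥ x) (V t)) (t : ℕ) :
    HasSecondMoment ((trajectoryLaw A B W π).map fun ω => ω t) joint (trajMoment A B W K V t) := by
  induction t with
  | zero =>
    rw [map_eval_zero_trajectoryLaw]
    intro i j
    refine ⟨integrable_dirac enorm_lt_top, ?_⟩
    rw [integral_dirac]
    cases i <;> simp [joint, trajMoment]
  | succ t ih =>
    rw [map_eval_succ_trajectoryLaw]
    have h1 := ih.compProd measurable_joint (hasCondMoments_nextState (A := A) (B := B) hW)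
    have h2 : HasSecondMoment
        (((trajectoryLaw A B W π).map (fun ω => ω t) ⊗ₘ nextState A B W).snd)
        (fun x : State d => x)
        (fromCols A B * trajMoment A B W K V t * (fromCols A B)ᵀ + W) := by
      rw [Measure.snd, hasSecondMoment_map_iff measurable_snd (fun i => by fun_prop)]
      exact fun i j => h1 (Sum.inr i) (Sum.inr j)
    exact h2.compProd (fun i => by fun_prop) (hπ (t + 1))

/-- The expected cost in terms of the second moments. -/
lemma expectedCost_eq_sum_trace (hW : W.PosSemidef) (π : Strategy d k)
    [∀ t, IsMarkovKernel (π t)] {K : ℕ → Matrix (Fin k) (Fin d) ℝ}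
    {V : ℕ → Matrix (Fin k) (Fin k) ℝ}
    (hπ : ∀ t, HasCondMoments (π t) (fun x => K t *ᵥ x) (V t))
    (Q : ℕ → Matrix (Fin d) (Fin d) ℝ) (R : ℕ → Matrix (Fin k) (Fin k) ℝ) (T : ℕ) :
    Integrable (totalCost Q R T) (trajectoryLaw A B W π) ∧
      expectedCost A B W Q R T π = ∑ t ∈ Finset.Icc 1 T,
        ((fromBlocks (Q t) 0 0 (R t))ᵀ * trajMoment A B W K V t).trace := by
  have e : totalCost Q R T = fun ω : ℕ → State d × Control k => ∑ t ∈ Finset.Icc 1 T,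
      joint (ω t) ⬝ᵥ (fromBlocks (Q t) 0 0 (R t) *ᵥ joint (ω t)) := by
    funext ω
    refine Finset.sum_congr rfl fun t _ => ?_
    simp [joint, fromBlocks_mulVec]
  have h := fun t => ((hasSecondMoment_map_iff (measurable_pi_apply t)
    measurable_joint).1 (hasSecondMoment_trajectoryLaw (A := A) (B := B) hW π hπ t)).quadratic
      (fromBlocks (Q t) 0 0 (R t))
  rw [expectedCost, e]
  refine ⟨integrable_finsetSum _ fun t _ => (h t).1, ?_⟩
  rw [integral_finsetSum _ fun t _ => (h t).1]
  exact Finset.sum_congr rfl fun t _ => (h t).2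

end Trajectory

/-! ### Block matrices supported on the graph of a gain -/

section Blocks

variable {d k : ℕ}

/-- The matrix of `x ↦ (x, K x)`. -/
def graphMatrix (K : Matrix (Fin k) (Fin d) ℝ) : Matrix (Fin d ⊕ Fin k) (Fin d) ℝ := fromRows 1 K

lemma graphMatrix_mul_mul (K : Matrix (Fin k) (Fin d) ℝ) (Y : Matrix (Fin d) (Fin d) ℝ) :
    graphMatrix K * Y * (graphMatrix K)ᵀ = fromBlocks Y (Y * Kᵀ) (K * Y) (K * Y * Kᵀ) := by
  simp [graphMatrix, transpose_fromRows, fromRows_mul]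

lemma trace_graphMatrix_mul_mul (K : Matrix (Fin k) (Fin d) ℝ) (Y : Matrix (Fin d) (Fin d) ℝ) :
    (graphMatrix K * Y * (graphMatrix K)ᵀ).trace = Y.trace + (K * Y * Kᵀ).trace := by
  simp [graphMatrix_mul_mul, trace, Fintype.sum_sum_type]

lemma fromCols_mul_graphMatrix_mul_mul (A : Matrix (Fin d) (Fin d) ℝ)
    (B : Matrix (Fin d) (Fin k) ℝ) (K : Matrix (Fin k) (Fin d) ℝ) (Y : Matrix (Fin d) (Fin d) ℝ) :
    fromCols A B * (graphMatrix K * Y * (graphMatrix K)ᵀ) * (fromCols A B)ᵀ =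
      (A + B * K) * Y * (A + B * K)ᵀ := by
  have h : fromCols A B * graphMatrix K = A + B * K := by
    simp [graphMatrix, fromCols_mul_fromRows]
  rw [← h, transpose_mul]
  simp only [Matrix.mul_assoc]

lemma frobNorm_toBlocks₁₁_le (S : BlockMatrix d k) : frobNorm S.toBlocks₁₁ ≤ frobNorm S := by
  refine Real.sqrt_le_sqrt ?_
  simp only [Fintype.sum_sum_type, toBlocks₁₁, of_apply]
  have h1 : ∀ i, (∑ j, S (Sum.inl i) (Sum.inl j) ^ 2) ≤
      ∑ j, S (Sum.inl i) (Sum.inl j) ^ 2 + ∑ j, S (Sum.inl i) (Sum.inr j) ^ 2 := fun i =>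
    le_add_of_nonneg_right (Finset.sum_nonneg fun _ _ => sq_nonneg _)
  refine (Finset.sum_le_sum fun i _ => h1 i).trans (le_add_of_nonneg_right ?_)
  positivity

lemma _root_.Matrix.PosSemidef.fromBlocks_zero {P : Matrix (Fin d) (Fin d) ℝ}
    {V : Matrix (Fin k) (Fin k) ℝ} (hP : P.PosSemidef) (hV : V.PosSemidef) :
    (fromBlocks P 0 0 V).PosSemidef := by
  refine posSemidef_iff_real.2 ⟨?_, fun x => ?_⟩
  · simp [fromBlocks_transpose, hP.transpose_eq, hV.transpose_eq]
  · rw [← Sum.elim_comp_inl_inr x, fromBlocks_mulVec]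
    simp only [zero_mulVec, add_zero, zero_add, sumElim_dotProduct_sumElim, Sum.elim_comp_inl,
      Sum.elim_comp_inr]
    exact add_nonneg ((posSemidef_iff_real.1 hP).2 _) ((posSemidef_iff_real.1 hV).2 _)

end Blocks

/-! ## The feasible set of the semidefinite program -/

section Feasible

variable {d k : ℕ} {A : Matrix (Fin d) (Fin d) ℝ} {B : Matrix (Fin d) (Fin k) ℝ}
  {W : Matrix (Fin d) (Fin d) ℝ} {ν σ : ℝ} {S : BlockMatrix d k}

lemma isClosed_sdpFeasible : IsClosed (sdpFeasible A B W ν) := by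
  simp only [sdpFeasible, Set.ofPred_and]
  refine isClosed_posSemidef.inter ((isClosed_le ?_ continuous_const).inter (isClosed_eq ?_ ?_))
  · fun_prop
  · exact continuous_id.matrix_submatrix _ _
  · fun_prop

lemma convex_sdpFeasible : Convex ℝ (sdpFeasible A B W ν) := by
  rintro S ⟨hS, hSt, hSx⟩ S' ⟨hS', hSt', hSx'⟩ a b ha hb hab
  refine ⟨(hS.smul ha).add (hS'.smul hb), ?_, ?_⟩
  · rw [trace_add, trace_smul, trace_smul, smul_eq_mul, smul_eq_mul]
    calc a * S.trace + b * S'.trace ≤ a * ν + b * ν := by gcongr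
      _ = ν := by rw [← add_mul, hab, one_mul]
  · have h : (a • S + b • S').toBlocks₁₁ = a • S.toBlocks₁₁ + b • S'.toBlocks₁₁ := rfl
    rw [h, hSx, hSx', Matrix.mul_add, Matrix.add_mul, Matrix.mul_smul, Matrix.mul_smul,
      Matrix.smul_mul, Matrix.smul_mul]
    -- The lone W on the right becomes (a + b) • W, which makes the affine constraint visibly
    -- compatible with convex combinations.
    nth_rewrite 3 [← one_smul ℝ W]
    rw [← hab]
    module

lemma frobNorm_le_of_mem (hS : S ∈ sdpFeasible A B W ν) : frobNorm S ≤ ν :=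
  hS.1.frobNorm_le_trace.trans hS.2.1

lemma toBlocks₁₁_sub_posSemidef (hS : S ∈ sdpFeasible A B W ν) :
    (S.toBlocks₁₁ - W).PosSemidef := by
  rw [hS.2.2, add_sub_cancel_right]
  exact hS.1.mul_mul_transpose _

lemma toBlocks₁₁_sub_smul_posSemidef (hW : (W - σ ^ 2 • (1 : Matrix (Fin d) (Fin d) ℝ)).PosSemidef)
    (hS : S ∈ sdpFeasible A B W ν) :
    (S.toBlocks₁₁ - σ ^ 2 • (1 : Matrix (Fin d) (Fin d) ℝ)).PosSemidef := by
  have h := (toBlocks₁₁_sub_posSemidef hS).add hW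
  rwa [sub_add_sub_cancel] at h

lemma smul_one_sub_toBlocks₁₁_posSemidef (hS : S ∈ sdpFeasible A B W ν) :
    (ν • (1 : Matrix (Fin d) (Fin d) ℝ) - S.toBlocks₁₁).PosSemidef :=
  posSemidef_smul_one_sub (PosSemidef.transpose_eq (hS.1.submatrix _))
    ((frobNorm_toBlocks₁₁_le S).trans (frobNorm_le_of_mem hS))

/-- From σ² I ⪯ Σ_xx ⪯ ν I, read off on a diagonal entry, which exists since d > 0. -/
lemma sq_le_of_mem_sdpFeasible (hd : 0 < d)
    (hW : (W - σ ^ 2 • (1 : Matrix (Fin d) (Fin d) ℝ)).PosSemidef)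
    (hS : S ∈ sdpFeasible A B W ν) : σ ^ 2 ≤ ν := by
  have h := ((toBlocks₁₁_sub_smul_posSemidef hW hS).add
    (smul_one_sub_toBlocks₁₁_posSemidef hS)).diag_nonneg (i := ⟨0, hd⟩)
  simp at h
  linarith

lemma isUnit_det_toBlocks₁₁ (hσ : 0 < σ)
    (hW : (W - σ ^ 2 • (1 : Matrix (Fin d) (Fin d) ℝ)).PosSemidef)
    (hS : S ∈ sdpFeasible A B W ν) : IsUnit S.toBlocks₁₁.det := by
  have h : (S.toBlocks₁₁).PosDef := by
    have h1 : (σ ^ 2 • (1 : Matrix (Fin d) (Fin d) ℝ)).PosDef := PosDef.one.smul (by positivity)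
    simpa using h1.add_posSemidef (toBlocks₁₁_sub_smul_posSemidef hW hS)
  exact (isUnit_iff_isUnit_det _).1 h.isUnit

lemma gain_mul_toBlocks₁₁ (hσ : 0 < σ)
    (hW : (W - σ ^ 2 • (1 : Matrix (Fin d) (Fin d) ℝ)).PosSemidef)
    (hS : S ∈ sdpFeasible A B W ν) : gain S * S.toBlocks₁₁ = S.toBlocks₂₁ := by
  rw [gain, Matrix.mul_assoc, nonsing_inv_mul _ (isUnit_det_toBlocks₁₁ hσ hW hS), Matrix.mul_one]

lemma toBlocks₁₁_mul_gain_transpose (hσ : 0 < σ)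
    (hW : (W - σ ^ 2 • (1 : Matrix (Fin d) (Fin d) ℝ)).PosSemidef)
    (hS : S ∈ sdpFeasible A B W ν) : S.toBlocks₁₁ * (gain S)ᵀ = S.toBlocks₁₂ := by
  have h := congrArg transpose (gain_mul_toBlocks₁₁ hσ hW hS)
  have h1 : S.toBlocks₁₁ᵀ = S.toBlocks₁₁ := PosSemidef.transpose_eq (hS.1.submatrix _)
  rw [transpose_mul, h1] at h
  rw [h]
  ext i j
  exact congrFun (congrFun hS.1.transpose_eq (Sum.inl i)) (Sum.inr j)

/-- Explains the choice of K and V: a state with second moments Σ_xx followed by a control from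
𝒩(Kx, V) reproduces Σ exactly. -/
lemma eq_fromBlocks_gain (hσ : 0 < σ)
    (hW : (W - σ ^ 2 • (1 : Matrix (Fin d) (Fin d) ℝ)).PosSemidef)
    (hS : S ∈ sdpFeasible A B W ν) :
    S = graphMatrix (gain S) * S.toBlocks₁₁ * (graphMatrix (gain S))ᵀ +
      fromBlocks 0 0 0 (explorationCov S) := by
  rw [graphMatrix_mul_mul, fromBlocks_add, toBlocks₁₁_mul_gain_transpose hσ hW hS, add_zero,
    add_zero, explorationCov, add_sub_cancel, gain_mul_toBlocks₁₁ hσ hW hS, add_zero,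
    fromBlocks_toBlocks]

/-- V is the Schur complement of Σ_xx: conjugating Σ by (-K, I) annihilates the graph part and
leaves V. -/
lemma explorationCov_posSemidef (hσ : 0 < σ)
    (hW : (W - σ ^ 2 • (1 : Matrix (Fin d) (Fin d) ℝ)).PosSemidef)
    (hS : S ∈ sdpFeasible A B W ν) : (explorationCov S).PosSemidef := by
  have h := hS.1.mul_mul_transpose (fromCols (-gain S) (1 : Matrix (Fin k) (Fin k) ℝ))
  have e : fromCols (-gain S) (1 : Matrix (Fin k) (Fin k) ℝ) * graphMatrix (gain S) = 0 := by
    simp [graphMatrix, fromCols_mul_fromRows]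
  have e2 : fromCols (-gain S) (1 : Matrix (Fin k) (Fin k) ℝ) * S * (fromCols (-gain S) (1 : Matrix (Fin k) (Fin k) ℝ))ᵀ =
      explorationCov S := by
    nth_rewrite 2 [eq_fromBlocks_gain hσ hW hS]
    rw [Matrix.mul_add, ← Matrix.mul_assoc, ← Matrix.mul_assoc, e]
    simp [fromCols_mul_fromBlocks, transpose_fromCols, fromCols_mul_fromRows]
  rwa [e2] at h

/-- If the second moments at time `t` are dominated by a multiple of `Σ_t`, then so is the
covariance of the next state, with the same multiple of the next iterate. -/
lemma next_posSemidef {X' Y Z : Matrix (Fin d) (Fin d) ℝ} {c ρ ν ε : ℝ} (hc : 0 ≤ c) (hρ : 0 ≤ ρ)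
    (hρ1 : ρ ≤ 1) (hε : 0 ≤ ε) (hερ : ε ≤ ρ / 2) (hcε : c * ρ = 2 * ε)
    (hYZ : ((1 + c) • Z - Y).PosSemidef)
    (hW : (W - (ρ * ν) • (1 : Matrix (Fin d) (Fin d) ℝ)).PosSemidef)
    (hν : (ν • (1 : Matrix (Fin d) (Fin d) ℝ) - (Z + W)).PosSemidef)
    (hδ : ((ε * (ρ * ν)) • (1 : Matrix (Fin d) (Fin d) ℝ) - (Z + W - X')).PosSemidef)
    (hX' : (X' - (ρ * ν) • (1 : Matrix (Fin d) (Fin d) ℝ)).PosSemidef) (hX'0 : X'.PosSemidef) :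
    ((1 + c) • X' - (Y + W)).PosSemidef := by
  -- The chain is Y + W ⪯ (1+c)(Z+W) - cW ⪯ (1+c-cρ)(Z+W) ⪯ (1+c-cρ)(1+ε)X' ⪯ (1+c)X'. By cρ = 2ε
  -- the last slack is ε - cε + 2ε², and cε ≤ cρ/2 = ε.
  have ha : 0 ≤ 1 + c - c * ρ := by nlinarith
  have hb : 0 ≤ 1 + c - (1 + c - c * ρ) * (1 + ε) := by
    have : c * (1 - ρ) * ε ≤ c * (1 - ρ) * (ρ / 2) :=
      mul_le_mul_of_nonneg_left hερ (mul_nonneg hc (by linarith))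
    nlinarith [mul_nonneg (mul_nonneg hc hρ) hρ]
  have h := ((((hYZ.add (hW.smul hc)).add (hν.smul (mul_nonneg hc hρ))).add (hδ.smul ha)).add
    (hX'.smul (mul_nonneg ha hε))).add (hX'0.smul hb)
  convert h using 1
  module

end Feasible

/-! ## The iterates and the cost of the controller -/

section Controller

variable {d k : ℕ} {A : Matrix (Fin d) (Fin d) ℝ} {B : Matrix (Fin d) (Fin k) ℝ}
  {W : Matrix (Fin d) (Fin d) ℝ} {ν η σ : ℝ} {S₁ : BlockMatrix d k}
  {Q : ℕ → Matrix (Fin d) (Fin d) ℝ} {R : ℕ → Matrix (Fin k) (Fin k) ℝ}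

lemma trace_fromBlocks_zero (P : Matrix (Fin d) (Fin d) ℝ) (V : Matrix (Fin k) (Fin k) ℝ) :
    (fromBlocks P 0 0 V).trace = P.trace + V.trace := by
  simp [trace, Fintype.sum_sum_type]

lemma ogdIterate_succ {t : ℕ} (ht : 1 ≤ t) :
    ogdIterate A B W Q R ν η S₁ (t + 1) = frobProj (sdpFeasible A B W ν)
      (ogdIterate A B W Q R ν η S₁ t - η • fromBlocks (Q t) 0 0 (R t)) := by
  obtain ⟨t, rfl⟩ := Nat.exists_eq_add_of_le' ht
  rfl

lemma ogdIterate_mem (hS : S₁ ∈ sdpFeasible A B W ν) (t : ℕ) :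
    ogdIterate A B W Q R ν η S₁ t ∈ sdpFeasible A B W ν := by
  match t with
  | 0 => exact hS
  | 1 => exact hS
  | t + 2 => exact (frobProj_spec isClosed_sdpFeasible ⟨_, hS⟩ _).1

lemma inner_ogdIterate_nonpos (hS : S₁ ∈ sdpFeasible A B W ν) {t : ℕ} (ht : 1 ≤ t)
    {Y : BlockMatrix d k} (hY : Y ∈ sdpFeasible A B W ν) :
    inner ℝ (frobVec (ogdIterate A B W Q R ν η S₁ t) - η • frobVec (fromBlocks (Q t) 0 0 (R t)) -
        frobVec (ogdIterate A B W Q R ν η S₁ (t + 1)))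
      (frobVec Y - frobVec (ogdIterate A B W Q R ν η S₁ (t + 1))) ≤ 0 := by
  have h := inner_sub_frobProj_nonpos isClosed_sdpFeasible convex_sdpFeasible ⟨_, hS⟩
    (ogdIterate A B W Q R ν η S₁ t - η • fromBlocks (Q t) 0 0 (R t)) hY
  rwa [map_sub, map_smul, ← ogdIterate_succ ht] at h

lemma frobNorm_ogdIterate_sub_le (hη : 0 ≤ η) (hS : S₁ ∈ sdpFeasible A B W ν) {t : ℕ}
    (ht : 1 ≤ t) :
    frobNorm (ogdIterate A B W Q R ν η S₁ t - ogdIterate A B W Q R ν η S₁ (t + 1)) ≤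
      η * frobNorm (fromBlocks (Q t) 0 0 (R t)) := by
  rw [← norm_frobVec, ← norm_frobVec, map_sub]
  exact norm_sub_le_of_projected_step hη (inner_ogdIterate_nonpos hS ht (ogdIterate_mem hS t))

lemma sum_trace_ogdIterate_sub_le {G : ℝ} (hη : 0 < η) (hS : S₁ ∈ sdpFeasible A B W ν)
    {Y : BlockMatrix d k} (hY : Y ∈ sdpFeasible A B W ν) (T : ℕ)
    (hG : ∀ t ∈ Finset.Icc 1 T, frobNorm (fromBlocks (Q t) 0 0 (R t)) ≤ G) :
    ∑ t ∈ Finset.Icc 1 T, ((fromBlocks (Q t) 0 0 (R t))ᵀ *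
      (ogdIterate A B W Q R ν η S₁ t - Y)).trace ≤
        (2 * ν) ^ 2 / (2 * η) + η / 2 * G ^ 2 * T := by
  simp only [← inner_frobVec, map_sub]
  refine sum_inner_le_of_projected_steps hη
    (fun t => frobVec (ogdIterate A B W Q R ν η S₁ t))
    (fun t => frobVec (fromBlocks (Q t) 0 0 (R t))) (frobVec Y) T
    (fun t ht => inner_ogdIterate_nonpos hS (Finset.mem_Icc.1 ht).1 hY)
    (fun t ht => (norm_frobVec _).trans_le (hG t ht)) ?_
  refine (norm_sub_le _ _).trans ?_
  rw [norm_frobVec, norm_frobVec]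
  have h1 := frobNorm_le_of_mem (ogdIterate_mem (Q := Q) (R := R) (η := η) hS 1)
  have h2 := frobNorm_le_of_mem hY
  linarith

lemma trajMoment_succ (K : ℕ → Matrix (Fin k) (Fin d) ℝ) (V : ℕ → Matrix (Fin k) (Fin k) ℝ)
    (t : ℕ) : trajMoment A B W K V (t + 1) =
      graphMatrix (K (t + 1)) * (fromCols A B * trajMoment A B W K V t * (fromCols A B)ᵀ + W) *
        (graphMatrix (K (t + 1)))ᵀ + fromBlocks 0 0 0 (V (t + 1)) := by
  rw [graphMatrix_mul_mul, fromBlocks_add, add_zero, add_zero, add_zero]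
  rfl

/-- The second moments of the trajectory that follows slowly varying feasible points `Σ_t` are
dominated by multiples of `Σ_t`. -/
lemma smul_sub_trajMoment_posSemidef {s : ℕ → BlockMatrix d k} {T : ℕ} {c ε : ℝ} (hσ : 0 < σ)
    (hW : (W - σ ^ 2 • (1 : Matrix (Fin d) (Fin d) ℝ)).PosSemidef)
    (hs : ∀ t, s t ∈ sdpFeasible A B W ν) (hν : 0 < ν) (hσν : σ ^ 2 ≤ ν) (hc : 0 ≤ c) (hε : 0 ≤ ε)
    (hερ : ε ≤ σ ^ 2 / ν / 2) (hcε : c * (σ ^ 2 / ν) = 2 * ε)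
    (hgap : ∀ t ∈ Finset.Icc 1 T, frobNorm (s t - s (t + 1)) ≤ ε * σ ^ 2) {t : ℕ}
    (ht : t ∈ Finset.Icc 1 T) :
    ((1 + c) • s t - trajMoment A B W (fun t => gain (s t)) (fun t => explorationCov (s t))
      t).PosSemidef := by
  set M := trajMoment A B W (fun t => gain (s t)) (fun t => explorationCov (s t)) with hM
  -- Domination of the state block suffices: both sides pass through the same gain, and the
  -- exploration covariance leaves the surplus c • V ⪰ 0.
  have lift : ∀ t, ((1 + c) • (s (t + 1)).toBlocks₁₁ -
      (fromCols A B * M t * (fromCols A B)ᵀ + W)).PosSemidef →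
      ((1 + c) • s (t + 1) - M (t + 1)).PosSemidef := by
    intro t h
    have h1 := (h.mul_mul_transpose (graphMatrix (gain (s (t + 1))))).add
      ((PosSemidef.fromBlocks_zero (d := d) PosSemidef.zero
        (explorationCov_posSemidef hσ hW (hs (t + 1)))).smul hc)
    rw [hM, trajMoment_succ]
    nth_rewrite 1 [eq_fromBlocks_gain hσ hW (hs (t + 1))]
    convert h1 using 1
    simp only [Matrix.mul_sub, Matrix.sub_mul, Matrix.mul_smul, Matrix.smul_mul]
    module
  obtain ⟨h1, hT⟩ := Finset.mem_Icc.1 ht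
  induction t, h1 using Nat.le_induction with
  | base =>
    -- The first state is pure noise, and W ⪯ (Σ_1)_xx by feasibility.
    refine lift 0 ?_
    have h1 := (toBlocks₁₁_sub_posSemidef (hs 1)).add ((hs 1).1.submatrix Sum.inl |>.smul hc)
    convert h1 using 1
    simp only [hM, trajMoment, Matrix.mul_zero, Matrix.zero_mul, zero_add]
    change (1 + c) • (s 1).toBlocks₁₁ - W = (s 1).toBlocks₁₁ - W + c • (s 1).toBlocks₁₁
    module
  | succ t h1 ih =>
    have htT : t ∈ Finset.Icc 1 T := Finset.mem_Icc.2 ⟨h1, by omega⟩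
    have ih' := (ih htT (by omega)).mul_mul_transpose (fromCols A B)
    refine lift t ?_
    have hρν : σ ^ 2 / ν * ν = σ ^ 2 := div_mul_cancel₀ _ hν.ne'
    refine next_posSemidef (ρ := σ ^ 2 / ν) (ν := ν) (ε := ε)
      (Z := fromCols A B * s t * (fromCols A B)ᵀ) hc (by positivity)
      ((div_le_one hν).2 hσν) hε hερ hcε ?_ ?_ ?_ ?_ ?_ ((hs (t + 1)).1.submatrix _)
    · simpa only [Matrix.mul_sub, Matrix.sub_mul, Matrix.mul_smul, Matrix.smul_mul] using ih'
    · rwa [hρν]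
    · rw [← (hs t).2.2]
      exact smul_one_sub_toBlocks₁₁_posSemidef (hs t)
    · rw [hρν, ← (hs t).2.2]
      have hsym : (s t - s (t + 1))ᵀ = s t - s (t + 1) := by
        rw [transpose_sub, (hs t).1.transpose_eq, (hs (t + 1)).1.transpose_eq]
      refine posSemidef_smul_one_sub ?_ ((frobNorm_toBlocks₁₁_le (s t - s (t + 1))).trans
        (hgap t htT))
      exact congrArg toBlocks₁₁ hsym
    · rw [hρν]
      exact toBlocks₁₁_sub_smul_posSemidef hW (hs (t + 1))

end Controller

/-! ## The cost of a strongly stable linear policy -/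

section Comparator

variable {d k : ℕ} {A : Matrix (Fin d) (Fin d) ℝ} {B : Matrix (Fin d) (Fin k) ℝ}
  {W : Matrix (Fin d) (Fin d) ℝ} {κ γ lam : ℝ} {K : Matrix (Fin k) (Fin d) ℝ}

open scoped Matrix.Norms.L2Operator in
lemma opNorm_mul_le {l m n : Type*} [Fintype l] [Fintype m] [Fintype n] [DecidableEq m]
    [DecidableEq n] (M : Matrix l m ℝ) (N : Matrix m n ℝ) :
    opNorm (M * N) ≤ opNorm M * opNorm N :=
  l2_opNorm_mul M N

open scoped Matrix.Norms.L2Operator in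
lemma opNorm_one (hd : 0 < d) : opNorm (1 : Matrix (Fin d) (Fin d) ℝ) = 1 := by
  have : Nonempty (Fin d) := ⟨⟨0, hd⟩⟩
  exact CStarRing.norm_one (E := Matrix (Fin d) (Fin d) ℝ)

lemma opNorm_pow_le (hd : 0 < d) (L : Matrix (Fin d) (Fin d) ℝ) (n : ℕ) :
    opNorm (L ^ n) ≤ opNorm L ^ n := by
  induction n with
  | zero => simp [opNorm_one hd]
  | succ n ih =>
    rw [pow_succ, pow_succ]
    exact (opNorm_mul_le _ _).trans (mul_le_mul_of_nonneg_right ih (opNorm_nonneg _))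

/-- Submultiplicativity applied to 1 = H H⁻¹. -/
lemma IsStronglyStable.one_le (hd : 0 < d) (h : IsStronglyStable A B κ γ K) : 1 ≤ κ := by
  obtain ⟨_, _, _, _, L, H, hH, _, _, hκ⟩ := h
  refine le_trans ?_ hκ
  rw [← opNorm_one hd, ← mul_nonsing_inv H hH]
  exact opNorm_mul_le _ _

lemma IsStronglyStable.opNorm_pow_le (hd : 0 < d) (h : IsStronglyStable A B κ γ K) (n : ℕ) :
    opNorm ((A + B * K) ^ n) ≤ κ * (1 - γ) ^ n := by
  obtain ⟨_, _, hγ, _, L, H, hH, hM, hL, hκ⟩ := h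
  have e : (A + B * K) ^ n = H * L ^ n * H⁻¹ := by
    rw [hM]
    induction n with
    | zero => rw [pow_zero, pow_zero, Matrix.mul_one, mul_nonsing_inv H hH]
    | succ n ih =>
      rw [pow_succ, ih, pow_succ]
      simp only [Matrix.mul_assoc]
      rw [nonsing_inv_mul_cancel_left _ _ hH]
  have h1 : opNorm (L ^ n) ≤ (1 - γ) ^ n :=
    (OnlineLQ.opNorm_pow_le hd L n).trans (pow_le_pow_left₀ (opNorm_nonneg _) hL n)
  calc opNorm ((A + B * K) ^ n) ≤ opNorm (H * L ^ n) * opNorm H⁻¹ := e ▸ opNorm_mul_le _ _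
    _ ≤ opNorm H * opNorm (L ^ n) * opNorm H⁻¹ :=
      mul_le_mul_of_nonneg_right (opNorm_mul_le _ _) (opNorm_nonneg _)
    _ = opNorm H * opNorm H⁻¹ * opNorm (L ^ n) := by ring
    _ ≤ κ * (1 - γ) ^ n := mul_le_mul hκ h1 (opNorm_nonneg _)
      ((mul_nonneg (opNorm_nonneg _) (opNorm_nonneg _)).trans hκ)

lemma IsStronglyStable.trace_pow_mul_mul_le (hd : 0 < d) (h : IsStronglyStable A B κ γ K)
    {P : Matrix (Fin d) (Fin d) ℝ} (hP : P.PosSemidef) (n : ℕ) :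
    ((A + B * K) ^ n * P * ((A + B * K) ^ n)ᵀ).trace ≤ κ ^ 2 * P.trace * (1 - γ) ^ n := by
  have hγ0 : 0 ≤ 1 - γ := by linarith [h.2.2.1]
  have h1 := hP.trace_mul_mul_transpose_le ((A + B * K) ^ n)
  have h2 : opNorm ((A + B * K) ^ n) ^ 2 ≤ κ ^ 2 * (1 - γ) ^ n := by
    refine (pow_le_pow_left₀ (opNorm_nonneg _) (h.opNorm_pow_le hd n) 2).trans ?_
    rw [mul_pow, pow_two ((1 - γ) ^ n)]
    -- One of the two factors (1 - γ)^n is discarded, so that the geometric series sums to exactly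
    -- 1/γ.
    exact mul_le_mul_of_nonneg_left (mul_le_of_le_one_left (pow_nonneg hγ0 n)
      (pow_le_one₀ hγ0 (by linarith [h.2.1]))) (sq_nonneg _)
  refine h1.trans ((mul_le_mul_of_nonneg_right h2 hP.trace_nonneg).trans_eq (by ring))

/-- The stationary covariance matrix of a strongly stable linear policy. -/
lemma IsStronglyStable.exists_stationary (hd : 0 < d) (h : IsStronglyStable A B κ γ K)
    (hW : W.PosSemidef) :
    ∃ X : Matrix (Fin d) (Fin d) ℝ, X.PosSemidef ∧ X = (A + B * K) * X * (A + B * K)ᵀ + W ∧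
      X.trace ≤ κ ^ 2 * W.trace / γ := by
  set M := A + B * K with hM
  have hγ0 : 0 ≤ 1 - γ := by linarith [h.2.2.1]
  have hγ1 : 1 - γ < 1 := by linarith [h.2.1]
  have hgeo : HasSum (fun n : ℕ => κ ^ 2 * W.trace * (1 - γ) ^ n) (κ ^ 2 * W.trace / γ) := by
    have := (hasSum_geometric_of_lt_one hγ0 hγ1).mul_left (κ ^ 2 * W.trace)
    rwa [sub_sub_cancel, ← div_eq_mul_inv] at this
  have hpsd : ∀ n : ℕ, (M ^ n * W * (M ^ n)ᵀ).PosSemidef := fun n => hW.mul_mul_transpose _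
  have hsum : Summable fun n : ℕ => M ^ n * W * (M ^ n)ᵀ := by
    rw [← frobVec.summable]
    refine Summable.of_norm_bounded hgeo.summable fun n => ?_
    rw [norm_frobVec]
    exact (hpsd n).frobNorm_le_trace.trans (h.trace_pow_mul_mul_le hd hW n)
  obtain ⟨X, hX⟩ := hsum
  refine ⟨X, ?_, ?_, ?_⟩
  · exact isClosed_posSemidef.mem_of_tendsto hX.tendsto_sum_nat
      (Filter.Eventually.of_forall fun n => posSemidef_sum _ fun i _ => hpsd i)
  -- Here X = ∑ Mⁿ W (Mⁿ)ᵀ. Conjugation by M shifts the series by one index, losing only the term W.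
  · have h1 := (hasSum_nat_add_iff' 1).2 hX
    have h2 := (hX.mul_left M).mul_right Mᵀ
    have e : (fun n : ℕ => M ^ (n + 1) * W * (M ^ (n + 1))ᵀ) =
        fun n => M * (M ^ n * W * (M ^ n)ᵀ) * Mᵀ := by
      funext n
      rw [pow_succ', transpose_mul]
      simp only [Matrix.mul_assoc]
    rw [e] at h1
    have h3 := h1.unique h2
    simp only [Finset.sum_range_one, pow_zero, Matrix.one_mul, transpose_one, Matrix.mul_one] at h3
    rw [← h3, sub_add_cancel]
  · have htr : HasSum (fun n : ℕ => (M ^ n * W * (M ^ n)ᵀ).trace) X.trace :=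
      hX.map (traceAddMonoidHom (Fin d) ℝ) (by
        change Continuous fun P : Matrix (Fin d) (Fin d) ℝ => P.trace
        fun_prop)
    exact hasSum_le (fun n => h.trace_pow_mul_mul_le hd hW n) htr hgeo

/-- The deviation of the second moments under a linear policy from the stationary ones. -/
lemma stationary_sub_trajMoment {X : Matrix (Fin d) (Fin d) ℝ}
    (hX : X = (A + B * K) * X * (A + B * K)ᵀ + W) (n : ℕ) :
    graphMatrix K * X * (graphMatrix K)ᵀ - trajMoment A B W (fun _ => K) (fun _ => 0) n =
      graphMatrix K * ((A + B * K) ^ n * X * ((A + B * K) ^ n)ᵀ) * (graphMatrix K)ᵀ := by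
  induction n with
  | zero => simp [trajMoment]
  | succ n ih =>
    have h1 : trajMoment A B W (fun _ => K) (fun _ => 0) n =
        graphMatrix K * (X - (A + B * K) ^ n * X * ((A + B * K) ^ n)ᵀ) * (graphMatrix K)ᵀ := by
      rw [Matrix.mul_sub, Matrix.sub_mul, ← ih, sub_sub_cancel]
    rw [trajMoment_succ, h1, fromCols_mul_graphMatrix_mul_mul, fromBlocks_zero, add_zero,
      ← Matrix.sub_mul, ← Matrix.mul_sub]
    congr 2
    nth_rewrite 1 [hX]
    rw [pow_succ', transpose_mul]
    simp only [Matrix.mul_sub, Matrix.sub_mul, Matrix.mul_assoc]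
    abel

/-- The state and control blocks contribute 1 + ‖K‖² ≤ 1 + κ² ≤ 2κ², using κ ≥ 1. -/
lemma IsStronglyStable.trace_graphMatrix_le (hd : 0 < d) (h : IsStronglyStable A B κ γ K)
    {Y : Matrix (Fin d) (Fin d) ℝ} (hY : Y.PosSemidef) :
    (graphMatrix K * Y * (graphMatrix K)ᵀ).trace ≤ 2 * κ ^ 2 * Y.trace := by
  have h1 := hY.trace_mul_mul_transpose_le K
  have h2 : opNorm K ^ 2 ≤ κ ^ 2 := pow_le_pow_left₀ (opNorm_nonneg _) h.2.2.2.1 2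
  have h3 : 1 ≤ κ ^ 2 := one_le_pow₀ (h.one_le hd)
  rw [trace_graphMatrix_mul_mul]
  nlinarith [hY.trace_nonneg]

lemma IsStronglyStable.stationary_mem_sdpFeasible (hd : 0 < d) (h : IsStronglyStable A B κ γ K)
    {X : Matrix (Fin d) (Fin d) ℝ} (hXp : X.PosSemidef)
    (hX : X = (A + B * K) * X * (A + B * K)ᵀ + W) {ν : ℝ} (hν : 2 * κ ^ 2 * X.trace ≤ ν) :
    graphMatrix K * X * (graphMatrix K)ᵀ ∈ sdpFeasible A B W ν := by
  refine ⟨hXp.mul_mul_transpose _, (h.trace_graphMatrix_le hd hXp).trans hν, ?_⟩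
  rw [fromCols_mul_graphMatrix_mul_mul, ← hX, graphMatrix_mul_mul, toBlocks_fromBlocks₁₁]

end Comparator

/-! ## The regret bound -/

section Regret

variable {d k : ℕ} {A : Matrix (Fin d) (Fin d) ℝ} {B : Matrix (Fin d) (Fin k) ℝ}
  {W : Matrix (Fin d) (Fin d) ℝ} {σ lam C κ γ ν η : ℝ} {T : ℕ}
  {Q : ℕ → Matrix (Fin d) (Fin d) ℝ} {R : ℕ → Matrix (Fin k) (Fin k) ℝ}

lemma sum_pow_one_sub_le (hγ : 0 < γ) (hγ1 : γ ≤ 1) (T : ℕ) :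
    ∑ t ∈ Finset.Icc 1 T, (1 - γ) ^ t ≤ 1 / γ := by
  have h0 : 0 ≤ 1 - γ := by linarith
  have h := hasSum_geometric_of_lt_one h0 (by linarith)
  rw [sub_sub_cancel, ← one_div] at h
  exact sum_le_hasSum _ (fun t _ => pow_nonneg h0 t) h

lemma sum_trace_stationary_sub_le (hd : 0 < d) {K : Matrix (Fin k) (Fin d) ℝ}
    (h : IsStronglyStable A B κ γ K) (hC : 0 ≤ C)
    (hL : ∀ t ∈ Finset.Icc 1 T, (fromBlocks (Q t) 0 0 (R t)).PosSemidef ∧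
      (fromBlocks (Q t) 0 0 (R t)).trace ≤ C)
    {X : Matrix (Fin d) (Fin d) ℝ} (hXp : X.PosSemidef)
    (hX : X = (A + B * K) * X * (A + B * K)ᵀ + W) :
    ∑ t ∈ Finset.Icc 1 T, ((fromBlocks (Q t) 0 0 (R t))ᵀ *
      (graphMatrix K * X * (graphMatrix K)ᵀ -
        trajMoment A B W (fun _ => K) (fun _ => 0) t)).trace ≤
      2 * C * κ ^ 4 * X.trace / γ := by
  calc _ ≤ ∑ t ∈ Finset.Icc 1 T, 2 * C * κ ^ 4 * X.trace * (1 - γ) ^ t := by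
        refine Finset.sum_le_sum fun t ht => ?_
        have hY := hXp.mul_mul_transpose ((A + B * K) ^ t)
        have h1 := (hL t ht).1.trace_mul_le (hY.mul_mul_transpose (graphMatrix K))
        have h2 : (graphMatrix K * ((A + B * K) ^ t * X * ((A + B * K) ^ t)ᵀ) *
            (graphMatrix K)ᵀ).trace ≤ 2 * κ ^ 2 * (κ ^ 2 * X.trace * (1 - γ) ^ t) :=
          (h.trace_graphMatrix_le hd hY).trans
            (mul_le_mul_of_nonneg_left (h.trace_pow_mul_mul_le hd hXp t) (by positivity))
        rw [stationary_sub_trajMoment hX, (hL t ht).1.transpose_eq]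
        refine h1.trans ((mul_le_mul (hL t ht).2 h2
          (hY.mul_mul_transpose (graphMatrix K)).trace_nonneg hC).trans_eq (by ring))
    _ ≤ 2 * C * κ ^ 4 * X.trace * (1 / γ) := by
        rw [← Finset.mul_sum]
        have := hXp.trace_nonneg
        exact mul_le_mul_of_nonneg_left (sum_pow_one_sub_le h.2.1 h.2.2.1 T) (by positivity)
    _ = 2 * C * κ ^ 4 * X.trace / γ := by ring

/-- Pairing with a positive semidefinite loss preserves the Loewner bound; the excess per round is c
tr(L_t Σ_t) ≤ c C ν. -/
lemma sum_trace_trajMoment_le {s : ℕ → BlockMatrix d k} {m : ℕ → BlockMatrix d k} {c : ℝ}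
    (hc : 0 ≤ c) (hC : 0 ≤ C) (hs : ∀ t, s t ∈ sdpFeasible A B W ν)
    (hL : ∀ t ∈ Finset.Icc 1 T, (fromBlocks (Q t) 0 0 (R t)).PosSemidef ∧
      (fromBlocks (Q t) 0 0 (R t)).trace ≤ C)
    (hm : ∀ t ∈ Finset.Icc 1 T, ((1 + c) • s t - m t).PosSemidef) :
    ∑ t ∈ Finset.Icc 1 T, ((fromBlocks (Q t) 0 0 (R t))ᵀ * m t).trace ≤
      ∑ t ∈ Finset.Icc 1 T, ((fromBlocks (Q t) 0 0 (R t))ᵀ * s t).trace + c * (C * ν) * T := by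
  have key : ∀ t ∈ Finset.Icc 1 T, ((fromBlocks (Q t) 0 0 (R t))ᵀ * m t).trace ≤
      ((fromBlocks (Q t) 0 0 (R t))ᵀ * s t).trace + c * (C * ν) := by
    intro t ht
    have h1 := (hL t ht).1.trace_mul_nonneg (hm t ht)
    have h2 := ((hL t ht).1.trace_mul_le (hs t).1).trans
      (mul_le_mul (hL t ht).2 (hs t).2.1 (hs t).1.trace_nonneg hC)
    have h3 := mul_le_mul_of_nonneg_left h2 hc
    rw [Matrix.mul_sub, trace_sub, Matrix.mul_smul, trace_smul, smul_eq_mul] at h1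
    rw [(hL t ht).1.transpose_eq]
    linarith
  refine (Finset.sum_le_sum key).trans_eq ?_
  rw [Finset.sum_add_distrib, Finset.sum_const, Nat.card_Icc, nsmul_eq_mul]
  simp [mul_comm]

/-- The regret of the online controller for an arbitrary (small enough) step size. -/
lemma regret_le (hd : 0 < d) (hσ : 0 < σ) (hC : 0 < C) (hWt : W.trace ≤ lam ^ 2)
    (hW : (W - σ ^ 2 • (1 : Matrix (Fin d) (Fin d) ℝ)).PosSemidef)
    (hQR : ∀ t ∈ Finset.Icc 1 T,
      (Q t).PosDef ∧ (R t).PosDef ∧ (Q t).trace ≤ C ∧ (R t).trace ≤ C)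
    (hν : ν = 2 * κ ^ 4 * lam ^ 2 / γ) (hη : 0 < η)
    (hην : 2 * C * η / σ ^ 2 ≤ σ ^ 2 / ν / 2)
    {S₁ : BlockMatrix d k} (hS : S₁ ∈ sdpFeasible A B W ν)
    {K : Matrix (Fin k) (Fin d) ℝ} (hK : IsStronglyStable A B κ γ K) :
    Integrable (totalCost Q R T) (trajectoryLaw A B W (onlineController A B W Q R ν η S₁)) ∧
      Integrable (totalCost Q R T) (trajectoryLaw A B W (linearPolicy K)) ∧
      expectedCost A B W Q R T (onlineController A B W Q R ν η S₁)
          - expectedCost A B W Q R T (linearPolicy K) ≤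
        2 * ν ^ 2 / η + 2 * η * C ^ 2 * T + 8 * C ^ 2 * η * ν ^ 2 / σ ^ 4 * T +
          4 * C * κ ^ 6 * lam ^ 2 / γ ^ 2 := by
  have hκ : 0 < κ := hK.1
  have hγ : 0 < γ := hK.2.1
  have hWp : W.PosSemidef := by
    have h := hW.add ((PosSemidef.one (n := Fin d) (R := ℝ)).smul (sq_nonneg σ))
    rwa [sub_add_cancel] at h
  have hσν : σ ^ 2 ≤ ν := sq_le_of_mem_sdpFeasible hd hW hS
  have hν0 : 0 < ν := lt_of_lt_of_le (by positivity) hσν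
  have hL : ∀ t ∈ Finset.Icc 1 T, (fromBlocks (Q t) 0 0 (R t)).PosSemidef ∧
      (fromBlocks (Q t) 0 0 (R t)).trace ≤ 2 * C := fun t ht => by
    obtain ⟨h1, h2, h3, h4⟩ := hQR t ht
    refine ⟨PosSemidef.fromBlocks_zero h1.posSemidef h2.posSemidef, ?_⟩
    rw [trace_fromBlocks_zero]
    linarith
  have hLn : ∀ t ∈ Finset.Icc 1 T, frobNorm (fromBlocks (Q t) 0 0 (R t)) ≤ 2 * C := fun t ht =>
    (hL t ht).1.frobNorm_le_trace.trans (hL t ht).2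
  set s := ogdIterate A B W Q R ν η S₁ with hs
  have hsm : ∀ t, s t ∈ sdpFeasible A B W ν := ogdIterate_mem hS
  obtain ⟨hi1, hJ1⟩ := expectedCost_eq_sum_trace (A := A) (B := B) hWp
    (onlineController A B W Q R ν η S₁) (K := fun t => gain (s t))
    (V := fun t => explorationCov (s t))
    (fun t => hasCondMoments_gaussianKernel _ _ (explorationCov_posSemidef hσ hW (hsm t))) Q R T
  obtain ⟨hi2, hJ2⟩ := expectedCost_eq_sum_trace (A := A) (B := B) hWp (linearPolicy K)
    (K := fun _ => K) (V := fun _ => 0) (fun t => hasCondMoments_deterministic _) Q R T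
  refine ⟨hi1, hi2, ?_⟩
  obtain ⟨X, hXp, hX, hXt⟩ := hK.exists_stationary hd hWp
  have hXt' : X.trace ≤ κ ^ 2 * lam ^ 2 / γ := hXt.trans (by gcongr)
  have hXm : graphMatrix K * X * (graphMatrix K)ᵀ ∈ sdpFeasible A B W ν := by
    refine hK.stationary_mem_sdpFeasible hd hXp hX ?_
    calc 2 * κ ^ 2 * X.trace ≤ 2 * κ ^ 2 * (κ ^ 2 * lam ^ 2 / γ) := by gcongr
      _ = ν := by rw [hν]; ring
  have hcomp := sum_trace_stationary_sub_le hd hK (by positivity : 0 ≤ 2 * C) hL hXp hX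
  have hogd := sum_trace_ogdIterate_sub_le (η := η) hη hS hXm T hLn
  -- The drift per round is at most 2Cη = εσ², so ε = 2Cη/σ², and c = 2ε/ρ with ρ = σ²/ν. The bound
  -- 2C arises from tr Q_t + tr R_t.
  have hdom := sum_trace_trajMoment_le (c := 2 * (2 * C * η / σ ^ 2) / (σ ^ 2 / ν))
    (by positivity) (by positivity : 0 ≤ 2 * C) hsm hL (fun t ht =>
      smul_sub_trajMoment_posSemidef hσ hW hsm hν0 hσν (by positivity)
        (by positivity : 0 ≤ 2 * C * η / σ ^ 2) hην (div_mul_cancel₀ _ (by positivity))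
        (fun t ht => (frobNorm_ogdIterate_sub_le hη.le hS (Finset.mem_Icc.1 ht).1).trans
          ((mul_le_mul_of_nonneg_left (hLn t ht) hη.le).trans_eq (by field_simp))) ht)
  have hlast : 2 * (2 * C) * κ ^ 4 * X.trace / γ ≤ 4 * C * κ ^ 6 * lam ^ 2 / γ ^ 2 := by
    calc _ ≤ 2 * (2 * C) * κ ^ 4 * (κ ^ 2 * lam ^ 2 / γ) / γ := by gcongr
      _ = _ := by ring
  have e1 : (2 * ν) ^ 2 / (2 * η) + η / 2 * (2 * C) ^ 2 * T =
      2 * ν ^ 2 / η + 2 * η * C ^ 2 * T := by field_simp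
  have e2 : 2 * (2 * C * η / σ ^ 2) / (σ ^ 2 / ν) * (2 * C * ν) * T =
      8 * C ^ 2 * η * ν ^ 2 / σ ^ 4 * T := by field_simp; ring
  rw [e1] at hogd
  rw [e2] at hdom
  simp only [Matrix.mul_sub, trace_sub, Finset.sum_sub_distrib] at hcomp hogd
  rw [hJ1, hJ2]
  linarith

/-- Taking traces, d σ² ≤ tr W ≤ λ². -/
lemma sigma_le_lam (hd : 0 < d) (hσ : 0 < σ) (hlam : 0 < lam) (hWt : W.trace ≤ lam ^ 2)
    (hW : (W - σ ^ 2 • (1 : Matrix (Fin d) (Fin d) ℝ)).PosSemidef) : σ ≤ lam := by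
  have h := hW.trace_nonneg
  rw [trace_sub, trace_smul, trace_one, Fintype.card_fin, smul_eq_mul] at h
  have hd' : (1 : ℝ) ≤ d := by exact_mod_cast hd
  refine (pow_le_pow_iff_left₀ hσ.le hlam.le two_ne_zero).1 ?_
  nlinarith [sq_nonneg σ]

/-- The regret bound for the step size `σ³ / (2 C √(ν T))`, with `s = √ν` and `r = √T`. -/
lemma regret_terms_le {s r q : ℝ} (hσ : 0 < σ) (hlam : 0 < lam) (hσl : σ ≤ lam) (hC : 0 < C)
    (hκ : 1 ≤ κ) (hγ : 0 < γ) (hs : 0 < s) (hσs : σ ≤ s) (hr : 1 ≤ r) (hq : 0 < q)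
    (hsq : s ^ 2 = 2 * q ^ 2) (hq4 : q ^ 4 = κ ^ 8 * lam ^ 4 / γ ^ 2)
    (hη : η = σ ^ 3 / (2 * C * (s * r))) :
    2 * (s ^ 2) ^ 2 / η + 2 * η * C ^ 2 * r ^ 2 + 8 * C ^ 2 * η * (s ^ 2) ^ 2 / σ ^ 4 * r ^ 2 +
      4 * C * κ ^ 6 * lam ^ 2 / γ ^ 2 ≤ 60 * (q ^ 5 / σ ^ 3 * C * r) := by
  have hr0 : 0 < r := by linarith
  have hκ0 : 0 < κ := by linarith
  -- All four terms are measured in the unit C s⁵ r / σ³, with weights 4, 1, 4 and 1.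
  have t1 : 2 * (s ^ 2) ^ 2 / η = 4 * (C * s ^ 5 * r / σ ^ 3) := by
    rw [hη]; field_simp; ring
  have t2 : 2 * η * C ^ 2 * r ^ 2 ≤ C * s ^ 5 * r / σ ^ 3 := by
    have e : 2 * η * C ^ 2 * r ^ 2 = C * r * (σ ^ 3 / s) := by rw [hη]; field_simp
    rw [e, show C * s ^ 5 * r / σ ^ 3 = C * r * (s ^ 5 / σ ^ 3) by ring]
    refine mul_le_mul_of_nonneg_left ?_ (by positivity)
    rw [div_le_div_iff₀ hs (by positivity), ← pow_add, ← pow_succ]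
    exact pow_le_pow_left₀ hσ.le hσs 6
  have t3 : 8 * C ^ 2 * η * (s ^ 2) ^ 2 / σ ^ 4 * r ^ 2 ≤ 4 * (C * s ^ 5 * r / σ ^ 3) := by
    have e : 8 * C ^ 2 * η * (s ^ 2) ^ 2 / σ ^ 4 * r ^ 2 = 4 * C * r * (s ^ 3 / σ) := by
      rw [hη]; field_simp; ring
    rw [e, show 4 * (C * s ^ 5 * r / σ ^ 3) = 4 * C * r * (s ^ 5 / σ ^ 3) by ring]
    refine mul_le_mul_of_nonneg_left ?_ (by positivity)
    rw [div_le_div_iff₀ hσ (by positivity), show s ^ 3 * σ ^ 3 = s ^ 3 * σ ^ 2 * σ by ring,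
      show s ^ 5 * σ = s ^ 3 * s ^ 2 * σ by ring]
    gcongr
  have t4 : 4 * C * κ ^ 6 * lam ^ 2 / γ ^ 2 ≤ C * s ^ 5 * r / σ ^ 3 := by
    calc 4 * C * κ ^ 6 * lam ^ 2 / γ ^ 2
        = 4 * C / γ ^ 2 * (κ ^ 6 * lam ^ 2) * 1 * 1 := by ring
      _ ≤ 4 * C / γ ^ 2 * (κ ^ 8 * lam ^ 2) * (lam ^ 2 / σ ^ 2) * (s / σ * r) := by
          have h1 : κ ^ 6 ≤ κ ^ 8 := pow_le_pow_right₀ hκ (by norm_num)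
          have h2 : 1 ≤ lam ^ 2 / σ ^ 2 := by
            rw [one_le_div (by positivity)]; exact pow_le_pow_left₀ hσ.le hσl 2
          have h3 : 1 ≤ s / σ * r := one_le_mul_of_one_le_of_one_le ((one_le_div hσ).2 hσs) hr
          gcongr
      _ = 4 * C * (κ ^ 8 * lam ^ 4 / γ ^ 2) / σ ^ 2 * (s / σ * r) := by ring
      _ = C * (s ^ 2) ^ 2 / σ ^ 2 * (s / σ * r) := by rw [← hq4, hsq]; ring
      _ = C * s ^ 5 * r / σ ^ 3 := by field_simp
  -- As s = √2 q ≤ (3/2) q and s⁴ = 4 q⁴, the total weight 10 becomes the constant 60.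
  have t5 : s ^ 5 ≤ 6 * q ^ 5 := by
    have h1 : s ≤ 3 / 2 * q := by
      refine (pow_le_pow_iff_left₀ hs.le (by positivity) two_ne_zero).1 ?_
      nlinarith [sq_nonneg q]
    calc s ^ 5 = (s ^ 2) ^ 2 * s := by ring
      _ ≤ (s ^ 2) ^ 2 * (3 / 2 * q) := by gcongr
      _ = 6 * q ^ 5 := by rw [hsq]; ring
  have t6 : C * s ^ 5 * r / σ ^ 3 ≤ C * (6 * q ^ 5) * r / σ ^ 3 := by gcongr
  have t7 : C * (6 * q ^ 5) * r / σ ^ 3 = 6 * (q ^ 5 / σ ^ 3 * C * r) := by ring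
  linarith

end Regret

end OnlineLQ

open OnlineLQ
theorem mainTheorem1 :
    ∃ c : ℝ, 0 < c ∧
      ∀ (d k : ℕ), 0 < d →
      ∀ (A : Matrix (Fin d) (Fin d) ℝ) (B : Matrix (Fin d) (Fin k) ℝ)
        (W : Matrix (Fin d) (Fin d) ℝ) (σ lam C κ γ ν η : ℝ) (T : ℕ)
        (Q : ℕ → Matrix (Fin d) (Fin d) ℝ) (R : ℕ → Matrix (Fin k) (Fin k) ℝ),
        0 < σ → 0 < lam → 0 < C →
        W.trace ≤ lam ^ 2 →
        (W - σ ^ 2 • (1 : Matrix (Fin d) (Fin d) ℝ)).PosSemidef →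
        (∀ t ∈ Finset.Icc 1 T, (Q t).PosDef ∧ (R t).PosDef ∧ (Q t).trace ≤ C ∧ (R t).trace ≤ C) →
        0 < κ → 0 < γ → γ ≤ 1 →
        ν = 2 * κ ^ 4 * lam ^ 2 / γ →
        η = σ ^ 3 / (2 * C * √(ν * T)) →
        8 * κ ^ 4 * lam ^ 2 / (γ * σ ^ 2) ≤ (T : ℝ) →
        ∀ S₁ ∈ sdpFeasible A B W ν,
        ∀ Kstar : Matrix (Fin k) (Fin d) ℝ, IsStronglyStable A B κ γ Kstar →
          Integrable (totalCost Q R T)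
            (trajectoryLaw A B W (onlineController A B W Q R ν η S₁)) ∧
          Integrable (totalCost Q R T) (trajectoryLaw A B W (linearPolicy Kstar)) ∧
          expectedCost A B W Q R T (onlineController A B W Q R ν η S₁)
              - expectedCost A B W Q R T (linearPolicy Kstar)
            ≤ c * (κ ^ 10 * lam ^ 5 / (γ ^ (5 / 2 : ℝ) * σ ^ 3) * C * √(T : ℝ)) := by
  refine ⟨60, by norm_num, ?_⟩
  intro d k hd A B W σ lam C κ γ ν η T Q R hσ hlam hC hWt hW hQR hκ hγ _ hν hη hT S₁ hS K hK
  have hσν : σ ^ 2 ≤ ν := sq_le_of_mem_sdpFeasible hd hW hS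
  have hν0 : 0 < ν := lt_of_lt_of_le (by positivity) hσν
  have hs : 0 < √ν := Real.sqrt_pos.2 hν0
  have hs2 : √ν ^ 2 = ν := Real.sq_sqrt hν0.le
  have hr2 : √(T : ℝ) ^ 2 = T := Real.sq_sqrt (Nat.cast_nonneg T)
  have hσs : σ ≤ √ν := Real.le_sqrt_of_sq_le hσν
  -- The lower bound on T says exactly that T ≥ 4ν/σ².
  have hsr : 2 * √ν ≤ σ * √(T : ℝ) := by
    refine (pow_le_pow_iff_left₀ (by positivity) (by positivity) two_ne_zero).1 ?_
    rw [mul_pow, mul_pow, hs2, hr2]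
    rw [div_le_iff₀ (by positivity)] at hT
    rw [hν, mul_div_assoc', div_le_iff₀ hγ]
    linarith
  have hr : 1 ≤ √(T : ℝ) := by
    refine le_of_mul_le_mul_left ?_ hσ
    linarith
  have hη' : η = σ ^ 3 / (2 * C * (√ν * √(T : ℝ))) := by rw [hη, Real.sqrt_mul hν0.le]
  have hr0 : 0 < √(T : ℝ) := by linarith
  have hη0 : 0 < η := by rw [hη']; positivity
  -- The drift condition ε ≤ ρ/2 reads σ/√(νT) ≤ σ²/(2ν), which is equivalent to `hsr`.
  have hην : 2 * C * η / σ ^ 2 ≤ σ ^ 2 / ν / 2 := by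
    have e : 2 * C * η / σ ^ 2 = σ / (√ν * √(T : ℝ)) := by rw [hη']; field_simp
    rw [e, div_div, div_le_div_iff₀ (by positivity) (by positivity)]
    have h := mul_le_mul_of_nonneg_left hsr (mul_pos hσ hs).le
    rw [show σ * √ν * (2 * √ν) = σ * (√ν ^ 2 * 2) by ring, hs2] at h
    linarith
  obtain ⟨h1, h2, h3⟩ := regret_le hd hσ hC hWt hW hQR hν hη0 hην hS hK
  refine ⟨h1, h2, h3.trans ?_⟩
  have hg : 0 < √γ := Real.sqrt_pos.2 hγ
  have hg2 : √γ ^ 2 = γ := Real.sq_sqrt hγ.le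
  have hg5 : γ ^ (5 / 2 : ℝ) = √γ ^ 5 := by
    rw [Real.sqrt_eq_rpow, ← Real.rpow_natCast, ← Real.rpow_mul hγ.le]
    norm_num
  -- With this q one has ν = 2q², and q⁵ is the factor κ¹⁰λ⁵/γ^(5/2) of the final bound.
  have h4 := regret_terms_le (η := η) (q := κ ^ 2 * lam / √γ) hσ hlam
    (sigma_le_lam hd hσ hlam hWt hW) hC (hK.one_le hd) hγ hs hσs hr (by positivity)
    (by rw [hs2, hν, div_pow, hg2]; ring)
    (by rw [div_pow, show √γ ^ 4 = (√γ ^ 2) ^ 2 by ring, hg2]; ring) hη'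
  rw [hs2, hr2] at h4
  refine h4.trans_eq ?_
  rw [hg5, div_pow, div_div]
  ring
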